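/- Oriented links are nonempty, tame, oriented links in $\mathbb R^3$, i.e. disjoint unions of finitely many oriented simple closed polygons, considered up to ambient isotopy. A $\mathbb Z[t^{\pm 1/2}]$-valued invariant of oriented links is a function $\Delta$ from oriented links to $\mathbb Z[t^{\pm1/2}]$ that takes equal values on links which are ambient isotopic as oriented links. For links $L_{\beta_1},\dots,L_{\beta_k}$ that are identical outside a solid cylinder and that are, inside the cylinder, the geometric braids $\beta_1,\dots,\beta_k$ (all strands oriented downwards), write $\Delta(\beta_i)$ for $\Delta(L_{\beta_i})$. Let $\sigma_1,\sigma_2$ be the standard braid generators and $e$ the trivial braid. A link is the split union $L_1\sqcup L_2$ of two (nonempty) links if it is isotopic to the union of a copy of $L_1$ and a copy of $L_2$ that lie on opposite sides of a plane; it is a split link if it is the split union of some two links. Assume that $\Delta$ is a $\mathbb Z[t^{\pm1/2}]$-valued invariant of oriented links such that, for all links which are identical outside a cylinder and are the indicated braids inside it, $$\Delta(\sigma_1^2)+\Delta(\sigma_1^{-2})=(t+t^{-1})\,\Delta(e)\qquad(\mathrm{II}_\Delta)$$ for $2$-braids, and $$\Delta(\sigma_1\sigma_2\sigma_1^{-1})-\Delta(\sigma_1\sigma_2^{-1}\sigma_1^{-1})=\Delta(\sigma_1^{-1}\sigma_2\sigma_1)-\Delta(\sigma_1^{-1}\sigma_2^{-1}\sigma_1)\qquad(\mathrm{III}_\Delta)$$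 for $3$-braids. Then $\Delta(L)=0$ for every split link $L$. In particular, for every oriented link $L$ and the unknot $O$, $$\Delta(L\sqcup O)=0.\qquad(\mathrm{IO}_\Delta)$$ -/

import Mathlib

/-- Three-space, with coordinates `(x, y, z)`: `x` to the right, `y` away from the viewer,
`z` upwards. Only its topology, affine structure and orientation matter. -/
abbrev R3 : Type := ℝ × ℝ × ℝ

/-- The straight segment underlying a directed edge `e`, which runs from `e.1` to `e.2`. -/
def edgeSegment (e : R3 × R3) : Set R3 := segment ℝ e.1 e.2

/-- An oriented (tame) link in three-space, given as an oriented polygonal link: a nonempty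
finite set of directed edges in which every edge has exactly one successor and exactly one
predecessor, and in which two different edges meet at most in common endpoints. The components
are the directed closed polygons formed by the edges. -/
structure OrientedLink where
  edges : Set (R3 × R3)
  finite : edges.Finite
  nonempty : edges.Nonempty
  nondegenerate : ∀ e ∈ edges, e.1 ≠ e.2
  next : ∀ e ∈ edges, ∃! f, f ∈ edges ∧ f.1 = e.2
  prev : ∀ e ∈ edges, ∃! f, f ∈ edges ∧ f.2 = e.1
  embedded : ∀ e ∈ edges, ∀ f ∈ edges, e ≠ f →
    edgeSegment e ∩ edgeSegment f ⊆ {e.1, e.2} ∩ {f.1, f.2}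

/-- An ambient isotopy of three-space: a continuous family of homeomorphisms, indexed by the
unit interval, that starts at the identity. -/
def IsAmbientIsotopy (H : unitInterval × R3 → R3) : Prop :=
  Continuous H ∧ (∀ t, IsHomeomorph fun p => H (t, p)) ∧ ∀ p, H (0, p) = p

namespace OrientedLink

/-- The underlying subset of three-space. -/
def support (L : OrientedLink) : Set R3 := ⋃ e ∈ L.edges, edgeSegment e

/-- `M` is a subdivision of `L`: the same oriented subset of three-space, with possibly more
vertices. -/
def Refines (M L : OrientedLink) : Prop :=
  M.support = L.support ∧
    ∀ e ∈ M.edges, ∃ f ∈ L.edges, edgeSegment e ⊆ edgeSegment f ∧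
      ∃ r : ℝ, 0 < r ∧ e.2 - e.1 = r • (f.2 - f.1)

/-- Isotopy of oriented links: the final homeomorphism of some ambient isotopy carries the first
oriented link onto the second one. To express that orientations are preserved, both links are
subdivided so that directed edges are carried onto directed edges (this is always possible: add
the images and preimages of vertices as new vertices). The homeomorphism need not be affine on
the edges. -/
def Isotopic (L L' : OrientedLink) : Prop :=
  ∃ M M' : OrientedLink, M.Refines L ∧ M'.Refines L' ∧
    ∃ H : unitInterval × R3 → R3, IsAmbientIsotopy H ∧
      M'.edges = (fun e : R3 × R3 => (H (1, e.1), H (1, e.2))) '' M.edges ∧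
      ∀ e ∈ M.edges, (fun p => H (1, p)) '' edgeSegment e = edgeSegment (H (1, e.1), H (1, e.2))

/-- The unknot: a link isotopic to a triangle. -/
def IsUnknot (L : OrientedLink) : Prop :=
  ∃ T : OrientedLink, T.edges.ncard = 3 ∧ L.Isotopic T

/-- `L` is the split union `L₁ ⊔ L₂`: up to isotopy, `L` consists of a copy of `L₁` and a copy
of `L₂` that lie on opposite sides of a plane. -/
def IsSplitUnion (L₁ L₂ L : OrientedLink) : Prop :=
  ∃ A B M : OrientedLink, L₁.Isotopic A ∧ L₂.Isotopic B ∧ L.Isotopic M ∧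
    M.edges = A.edges ∪ B.edges ∧ (∀ p ∈ A.support, p.1 < 0) ∧ (∀ p ∈ B.support, 0 < p.1)

/-- A split link: a split union of two (nonempty) links. -/
def IsSplit (L : OrientedLink) : Prop :=
  ∃ L₁ L₂ : OrientedLink, IsSplitUnion L₁ L₂ L

end OrientedLink

/-- Letters of braid words: the trivial letter, the generators `σ i` (`1 ≤ i < n` for `n`-braids)
and their inverses. -/
inductive BraidLetter
  | one
  | sigma (i : ℕ)
  | sigmaInv (i : ℕ)

/-- The directed edges of an elementary `n`-braid between the heights `h + 1` (top) and `h`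
(bottom). Strands run downwards and have the positions `(j, 0)`, `1 ≤ j ≤ n`, at top and bottom.
The strands at the positions `i` and `i + 1` are exchanged; halfway down, the one which goes from
`i` to `i + 1` is at depth `d` and the other one at depth `-d`. -/
def crossingEdges (n i : ℕ) (d h : ℝ) : Set (R3 × R3) :=
  {e | ∃ j : ℕ, 1 ≤ j ∧ j ≤ n ∧ j ≠ i ∧ j ≠ i + 1 ∧ e = (((j : ℝ), 0, h + 1), ((j : ℝ), 0, h))} ∪
  {(((i : ℝ), 0, h + 1), ((i : ℝ) + 1 / 2, d, h + 1 / 2)),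
   (((i : ℝ) + 1 / 2, d, h + 1 / 2), ((i : ℝ) + 1, 0, h)),
   (((i : ℝ) + 1, 0, h + 1), ((i : ℝ) + 1 / 2, -d, h + 1 / 2)),
   (((i : ℝ) + 1 / 2, -d, h + 1 / 2), ((i : ℝ), 0, h))}

/-- The directed edges of the elementary `n`-braid of a letter, between the heights `h + 1` and
`h`. With this choice `sigma i` is a positive crossing. -/
def layerEdges (n : ℕ) (h : ℝ) : BraidLetter → Set (R3 × R3)
  | .one => {e | ∃ j : ℕ, 1 ≤ j ∧ j ≤ n ∧ e = (((j : ℝ), 0, h + 1), ((j : ℝ), 0, h))}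
  | .sigma i => crossingEdges n i (1 / 2) h
  | .sigmaInv i => crossingEdges n i (-(1 / 2)) h

/-- The geometric `n`-braid of a word, drawn from top to bottom: a word of length `k` lies
between the heights `k` and `0`, and its first letter is at the top. -/
def braidEdges (n : ℕ) : List BraidLetter → Set (R3 × R3)
  | [] => ∅
  | l :: w => layerEdges n w.length l ∪ braidEdges n w

/-- The solid cylinder (disc times interval) that contains the geometric `n`-braids of words of
length `k`. -/
def braidCylinder (n k : ℕ) : Set R3 :=
  Set.Icc (0 : ℝ) (n + 1) ×ˢ Set.Icc (-1 : ℝ) 1 ×ˢ Set.Icc (0 : ℝ) k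

/-- The endpoints of `n`-braids in the cylinder. -/
def braidEndpoints (n k : ℕ) : Set R3 :=
  {p | ∃ j : ℕ, 1 ≤ j ∧ j ≤ n ∧ (p = ((j : ℝ), 0, (k : ℝ)) ∨ p = ((j : ℝ), 0, 0))}

/-- The edges in `X` stay outside the cylinder, except that they may end at endpoints of the
braid. -/
def IsOutside (n k : ℕ) (X : Set (R3 × R3)) : Prop :=
  ∀ e ∈ X, edgeSegment e ∩ braidCylinder n k ⊆ braidEndpoints n k

/-- Inside the cylinder the link `L` is the braid `w`, and outside it is `X`. -/
def OrientedLink.IsBraidIn (L : OrientedLink) (n : ℕ) (w : List BraidLetter)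
    (X : Set (R3 × R3)) : Prop :=
  IsOutside n w.length X ∧ L.edges = X ∪ braidEdges n w

/-- An invariant of oriented links with values in `ℤ[t^{±1/2}]`. Here, and below, the variable
`T 1` of the ring of Laurent polynomials stands for `t^{1/2}`, so that `T 2` is `t`. -/
def IsLinkInvariant (D : OrientedLink → LaurentPolynomial ℤ) : Prop :=
  ∀ L L' : OrientedLink, L.Isotopic L' → D L = D L'

open BraidLetter LaurentPolynomial in
/-- The skein relation `D(σ₁²) + D(σ₁⁻²) = (t + t⁻¹) D(e)`, for links which are identical outside a
cylinder and are the indicated 2-braids in it. By isotopy invariance it is no restriction that the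
cylinder and the geometric braids in it are standard. -/
def SkeinRelationII (D : OrientedLink → LaurentPolynomial ℤ) : Prop :=
  ∀ (X : Set (R3 × R3)) (Lp Lm L0 : OrientedLink),
    Lp.IsBraidIn 2 [sigma 1, sigma 1] X →
    Lm.IsBraidIn 2 [sigmaInv 1, sigmaInv 1] X →
    L0.IsBraidIn 2 [one, one] X →
    D Lp + D Lm = (T 2 + T (-2)) * D L0

open BraidLetter in
/-- The skein relation
`D(σ₁σ₂σ₁⁻¹) - D(σ₁σ₂⁻¹σ₁⁻¹) = D(σ₁⁻¹σ₂σ₁) - D(σ₁⁻¹σ₂⁻¹σ₁)`, for links which are identical outside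
a cylinder and are the indicated 3-braids in it. -/
def SkeinRelationIII (D : OrientedLink → LaurentPolynomial ℤ) : Prop :=
  ∀ (X : Set (R3 × R3)) (L₁ L₂ L₃ L₄ : OrientedLink),
    L₁.IsBraidIn 3 [sigma 1, sigma 2, sigmaInv 1] X →
    L₂.IsBraidIn 3 [sigma 1, sigmaInv 2, sigmaInv 1] X →
    L₃.IsBraidIn 3 [sigmaInv 1, sigma 2, sigma 1] X →
    L₄.IsBraidIn 3 [sigmaInv 1, sigmaInv 2, sigma 1] X →
    D L₁ - D L₂ = D L₃ - D L₄

/-!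
A split link is isotopic to a link `N` consisting of a left body, a right body, and two long
vertical strands between them, one of which closes up the left body and the other the right body.
Clasping the two strands gives links `N(σ₁²)` and `N(σ₁⁻²)`, and relation (II) reads
`D(N(σ₁²)) + D(N(σ₁⁻²)) = (t + t⁻¹) D(N)`.

Now let the left body run through strands 1 → 3 and 2 → 2 of a 3-braid and the right body through
strand 3 → 1. With the braids `σ₁σ₂σ₁⁻¹` and `σ₁⁻¹σ₂⁻¹σ₁` the two strands can be pulled apart, which
gives `N`, and with `σ₁⁻¹σ₂σ₁` they form the clasp `σ₁²`. With `σ₁σ₂⁻¹σ₁⁻¹` they form the clasp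
`σ₁⁻²` after the left body has been rotated through a full turn. Hence relation (III) reads
`D(N) - D(N(σ₁⁻²)) = D(N(σ₁²)) - D(N)`. Adding the two relations gives `(t + t⁻¹ - 2) D(N) = 0` in
a ring without zero divisors.

The isotopies are composed of triangle moves on polygons whose vertices, apart from those in the
bodies, have half-integral coordinates, so that a sequence of moves can be checked by integer
arithmetic.
-/

open AffineMap (lineMap lineMap_apply)
open Complex (equivRealProdCLM)

section Segments

variable {E : Type*} [AddCommGroup E] [Module ℝ E]

theorem wbtw_or_wbtw_of_sameRay {v a b : E} (h : SameRay ℝ (a - v) (b - v)) :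
    Wbtw ℝ v a b ∨ Wbtw ℝ v b a := by
  obtain ⟨u, s, t, hs, ht, -, hsu, htu⟩ := h.exists_eq_smul
  rw [← sub_add_cancel a v, ← sub_add_cancel b v, hsu, htu]
  exact wbtw_or_wbtw_smul_vadd_of_nonneg v u hs ht

theorem segment_inter_segment_subset_singleton {p q r : E} (hp : p ∉ segment ℝ r q)
    (hq : q ∉ segment ℝ p r) : segment ℝ p r ∩ segment ℝ r q ⊆ {r} := by
  rintro x ⟨hxp, hxq⟩
  by_contra hxr
  rw [mem_segment_iff_wbtw] at hxp hxq hp hq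
  have hray : SameRay ℝ (p - r) (q - r) :=
    hxp.symm.sameRay_vsub_left.symm.trans hxq.sameRay_vsub_left
      fun h => absurd (sub_eq_zero.1 h) hxr
  exact (wbtw_or_wbtw_of_sameRay hray).elim hp fun h => hq h.symm

theorem pairwise_ne_of_notMem_segment {p q r : E} (hp : p ∉ segment ℝ r q)
    (hq : q ∉ segment ℝ p r) : p ≠ q ∧ p ≠ r ∧ r ≠ q :=
  ⟨fun h => hp (h ▸ right_mem_segment ℝ r p), fun h => hp (h ▸ left_mem_segment ℝ p q),
    fun h => hq (h ▸ right_mem_segment ℝ p r)⟩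

theorem notMem_segment_lineMap_of_wbtw {p m q r : E} (hm : Wbtw ℝ p m q) (hpm : p ≠ m)
    (hp : p ∉ segment ℝ r q) {s : ℝ} (hs : s ∈ Set.Icc (0 : ℝ) 1) :
    p ∉ segment ℝ (lineMap m r s) q := fun h => by
  rw [mem_segment_iff_wbtw] at hp h
  have hpm' : Wbtw ℝ m p (lineMap m r s) := (h.trans_right_left hm).symm
  have hpr : Wbtw ℝ m p r := Wbtw.trans_left ⟨s, hs, rfl⟩ hpm'
  exact hp (hpr.symm.trans_expand_left hm hpm)

theorem segment_union_segment_of_wbtw {p m q : E} (hm : Wbtw ℝ p m q) :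
    segment ℝ p m ∪ segment ℝ m q = segment ℝ p q := by
  obtain ⟨s, ⟨hs0, hs1⟩, rfl⟩ := hm
  have himage : ∀ a b : ℝ, a ≤ b → segment ℝ (lineMap p q a) (lineMap p q b) =
      lineMap p q '' Set.Icc a b := fun a b hab => by
    rw [← image_segment, segment_eq_Icc hab]
  have h0 := himage 0 s hs0
  have h1 := himage s 1 hs1
  have h01 := himage 0 1 zero_le_one
  rw [AffineMap.lineMap_apply_zero] at h0 h01
  rw [AffineMap.lineMap_apply_one] at h1 h01
  rw [h0, h1, h01, ← Set.image_union, Set.Icc_union_Icc_eq_Icc hs0 hs1]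

theorem segment_union_segment_subset_convexHull {p q r x : E}
    (hx : x ∈ convexHull ℝ {p, q, r}) :
    segment ℝ p x ∪ segment ℝ x q ⊆ convexHull ℝ {p, q, r} :=
  have hc := convex_convexHull ℝ ({p, q, r} : Set E)
  Set.union_subset (hc.segment_subset (subset_convexHull _ _ (by simp)) hx)
    (hc.segment_subset hx (subset_convexHull _ _ (by simp)))

end Segments

theorem injOn_insert_of_notMem_image {α β : Type*} {f : α → β} {s : Set α} {a : α}
    (hs : s.InjOn f) (ha : f a ∉ f '' s) : (insert a s).InjOn f :=
  (Set.injOn_insert fun h => ha (Set.mem_image_of_mem f h)).2 ⟨hs, ha⟩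

/-- Two directed edges meet at most in common endpoints. -/
def MeetAtEndpoints (e f : R3 × R3) : Prop :=
  edgeSegment e ∩ edgeSegment f ⊆ {e.1, e.2} ∩ {f.1, f.2}

instance : Std.Symm MeetAtEndpoints where
  symm e f h := by
    rw [MeetAtEndpoints, Set.inter_comm (edgeSegment f), Set.inter_comm {f.1, f.2}]
    exact h

namespace OrientedLink

theorem eq_of_edges_eq {L M : OrientedLink} (h : L.edges = M.edges) : L = M := by
  cases L; cases M; cases h; rfl

theorem pairwise_meetAtEndpoints (L : OrientedLink) : L.edges.Pairwise MeetAtEndpoints :=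
  fun e he f hf => L.embedded e he f hf

theorem injOn_fst (L : OrientedLink) : L.edges.InjOn Prod.fst := fun e he f hf h => by
  obtain ⟨g, ⟨hg, hge⟩, -⟩ := L.prev e he
  exact (L.next g hg).unique ⟨he, hge.symm⟩ ⟨hf, (hge.trans h).symm⟩

theorem injOn_snd (L : OrientedLink) : L.edges.InjOn Prod.snd := fun e he f hf h => by
  obtain ⟨g, ⟨hg, hge⟩, -⟩ := L.next e he
  exact (L.prev g hg).unique ⟨he, hge.symm⟩ ⟨hf, (hge.trans h).symm⟩

/-- The vertices of a link. -/
def vertices (L : OrientedLink) : Set R3 := Prod.fst '' L.edges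

theorem fst_mem_vertices {L : OrientedLink} {e : R3 × R3} (he : e ∈ L.edges) :
    e.1 ∈ L.vertices :=
  Set.mem_image_of_mem _ he

theorem snd_mem_vertices {L : OrientedLink} {e : R3 × R3} (he : e ∈ L.edges) :
    e.2 ∈ L.vertices :=
  let ⟨f, ⟨hf, hfe⟩, _⟩ := L.next e he
  ⟨f, hf, hfe⟩

theorem image_snd_edges (L : OrientedLink) : Prod.snd '' L.edges = L.vertices := by
  refine Set.Subset.antisymm (Set.image_subset_iff.2 fun e he => snd_mem_vertices he) ?_
  rintro _ ⟨e, he, rfl⟩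
  obtain ⟨f, ⟨hf, hfe⟩, -⟩ := L.prev e he
  exact ⟨f, hf, hfe⟩

/-- A finite set of directed edges is a link if the map from edges to their starting points and
the one to their end points are injective with the same image. -/
def ofInjOn (E : Set (R3 × R3)) (hfin : E.Finite) (hne : E.Nonempty) (hnd : ∀ e ∈ E, e.1 ≠ e.2)
    (hfst : E.InjOn Prod.fst) (hsnd : E.InjOn Prod.snd)
    (himage : Prod.fst '' E = Prod.snd '' E) (hmeet : E.Pairwise MeetAtEndpoints) :
    OrientedLink where
  edges := E
  finite := hfin
  nonempty := hne
  nondegenerate := hnd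
  next e he := by
    obtain ⟨f, hf, hfe⟩ := himage.superset (Set.mem_image_of_mem _ he)
    exact ⟨f, ⟨hf, hfe⟩, fun g hg => hfst hg.1 hf (hg.2.trans hfe.symm)⟩
  prev e he := by
    obtain ⟨f, hf, hfe⟩ := himage.subset (Set.mem_image_of_mem _ he)
    exact ⟨f, ⟨hf, hfe⟩, fun g hg => hsnd hg.1 hf (hg.2.trans hfe.symm)⟩
  embedded e he f hf := hmeet he hf

/-- The image of a link under an injective map that carries edges onto straight segments. -/
def map (L : OrientedLink) (φ : R3 → R3) (hφ : Function.Injective φ)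
    (hseg : ∀ e ∈ L.edges, φ '' edgeSegment e = edgeSegment (φ e.1, φ e.2)) : OrientedLink :=
  ofInjOn (Prod.map φ φ '' L.edges) (L.finite.image _) (L.nonempty.image _)
    (Set.forall_mem_image.2 fun _ he h => L.nondegenerate _ he (hφ h))
    (Set.InjOn.image_of_comp (hφ.injOn.comp L.injOn_fst (Set.mapsTo_univ _ _)))
    (Set.InjOn.image_of_comp (hφ.injOn.comp L.injOn_snd (Set.mapsTo_univ _ _)))
    (by
      simp only [Set.image_image, Prod.map_fst, Prod.map_snd]
      rw [← Set.image_image φ Prod.fst, ← Set.image_image φ Prod.snd, image_snd_edges, vertices])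
    (by
      rintro _ ⟨e, he, rfl⟩ _ ⟨f, hf, rfl⟩ hne
      change edgeSegment (φ e.1, φ e.2) ∩ edgeSegment (φ f.1, φ f.2) ⊆
        {φ e.1, φ e.2} ∩ {φ f.1, φ f.2}
      rw [← hseg e he, ← hseg f hf, ← Set.image_inter hφ, ← Set.image_pair, ← Set.image_pair,
        ← Set.image_inter hφ]
      exact Set.image_mono (L.embedded e he f hf (ne_of_apply_ne _ hne)))

theorem mem_endpoints_of_mem_vertices {L : OrientedLink} {v : R3} (hv : v ∈ L.vertices)
    {g : R3 × R3} (hg : g ∈ L.edges) (hvg : v ∈ edgeSegment g) : v ∈ ({g.1, g.2} : Set R3) := by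
  obtain ⟨e, he, rfl⟩ := hv
  rcases eq_or_ne e g with rfl | hne
  · exact Or.inl rfl
  · exact (L.embedded e he g hg hne ⟨left_mem_segment ℝ _ _, hvg⟩).2

theorem meetAtEndpoints_of_inter_subset {L : OrientedLink} {a b : R3} {g : R3 × R3}
    (hg : g ∈ L.edges) (h : segment ℝ a b ∩ edgeSegment g ⊆ {a, b} ∩ L.vertices) :
    MeetAtEndpoints (a, b) g :=
  fun _ hx => ⟨(h hx).1, mem_endpoints_of_mem_vertices (h hx).2 hg hx.2⟩

theorem notMem_vertices_of_mem_edgeSegment {L : OrientedLink} {p q r : R3} (hpr : p ≠ r)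
    (hrq : r ≠ q) (h : ∀ g ∈ L.edges, g ≠ (p, q) → r ∈ edgeSegment g → r ∈ ({p, q} : Set R3)) :
    r ∉ L.vertices := by
  rintro ⟨g, hg, rfl⟩
  have hne : g ≠ (p, q) := fun h => hpr (congrArg Prod.fst h).symm
  exact (h g hg hne (left_mem_segment ℝ _ _)).elim hpr.symm hrq

/-- Replace an edge `(p, q)` by the two edges `(p, r)` and `(r, q)`. -/
def splitEdge (L : OrientedLink) {p q : R3} (hpq : (p, q) ∈ L.edges) (r : R3)
    (hp : p ∉ segment ℝ r q) (hq : q ∉ segment ℝ p r)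
    (hsep : ∀ g ∈ L.edges, g ≠ (p, q) →
      (segment ℝ p r ∪ segment ℝ r q) ∩ edgeSegment g ⊆ {p, q}) : OrientedLink :=
  have hpr : p ≠ r := (pairwise_ne_of_notMem_segment hp hq).2.1
  have hrq : r ≠ q := (pairwise_ne_of_notMem_segment hp hq).2.2
  have hpL : p ∈ L.vertices := fst_mem_vertices hpq
  have hqL : q ∈ L.vertices := snd_mem_vertices hpq
  have hrL : r ∉ L.vertices := notMem_vertices_of_mem_edgeSegment hpr hrq fun g hg hne hrg =>
    hsep g hg hne ⟨Or.inl (right_mem_segment ℝ _ _), hrg⟩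
  have hfst : Prod.fst '' (L.edges \ {(p, q)}) = L.vertices \ {p} := by
    rw [L.injOn_fst.image_sdiff_subset (Set.singleton_subset_iff.2 hpq), Set.image_singleton,
      vertices]
  have hsnd : Prod.snd '' (L.edges \ {(p, q)}) = L.vertices \ {q} := by
    rw [L.injOn_snd.image_sdiff_subset (Set.singleton_subset_iff.2 hpq), Set.image_singleton,
      image_snd_edges]
  have hmeet_pr : ∀ g ∈ L.edges \ {(p, q)}, MeetAtEndpoints (p, r) g := fun g hg =>
    meetAtEndpoints_of_inter_subset hg.1 fun x hx => by
      obtain rfl : x = p := (hsep g hg.1 hg.2 ⟨Or.inl hx.1, hx.2⟩).resolve_right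
        fun h => hq (h ▸ hx.1)
      exact ⟨Or.inl rfl, hpL⟩
  have hmeet_rq : ∀ g ∈ L.edges \ {(p, q)}, MeetAtEndpoints (r, q) g := fun g hg =>
    meetAtEndpoints_of_inter_subset hg.1 fun x hx => by
      obtain rfl : x = q := (hsep g hg.1 hg.2 ⟨Or.inr hx.1, hx.2⟩).resolve_left
        fun h => hp (h ▸ hx.1)
      exact ⟨Or.inr rfl, hqL⟩
  have hmeet_r : MeetAtEndpoints (p, r) (r, q) :=
    (segment_inter_segment_subset_singleton hp hq).trans (by simp)
  ofInjOn (insert (p, r) (insert (r, q) (L.edges \ {(p, q)})))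
    ((L.finite.sdiff.insert _).insert _) (Set.insert_nonempty _ _)
    (by
      rintro e (rfl | rfl | he)
      exacts [hpr, hrq, L.nondegenerate e he.1])
    (injOn_insert_of_notMem_image
      (injOn_insert_of_notMem_image (L.injOn_fst.mono Set.sdiff_subset) (by simp [hfst, hrL]))
      (by simp [Set.image_insert_eq, hfst, hpr]))
    (injOn_insert_of_notMem_image
      (injOn_insert_of_notMem_image (L.injOn_snd.mono Set.sdiff_subset) (by simp [hsnd]))
      (by simp [Set.image_insert_eq, hsnd, hrq, hrL]))
    (by
      simp only [Set.image_insert_eq, hfst, hsnd]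
      rw [Set.insert_comm, Set.insert_sdiff_singleton, Set.insert_sdiff_singleton,
        Set.insert_eq_of_mem hpL, Set.insert_eq_of_mem hqL])
    (((L.pairwise_meetAtEndpoints.mono Set.sdiff_subset).insert_of_symm
      fun g hg _ => hmeet_rq g hg).insert_of_symm (by
        rintro g (rfl | hg) _
        exacts [hmeet_r, hmeet_pr g hg]))

/-- Replace two consecutive edges `(p, r)` and `(r, q)` by the edge `(p, q)`. -/
def mergeEdges (L : OrientedLink) {p q r : R3} (hpr : (p, r) ∈ L.edges) (hrq : (r, q) ∈ L.edges)
    (hpq : p ≠ q)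
    (hsep : ∀ g ∈ L.edges, g ≠ (p, r) → g ≠ (r, q) →
      segment ℝ p q ∩ edgeSegment g ⊆ {p, q}) : OrientedLink :=
  have hpL : p ∈ L.vertices := fst_mem_vertices hpr
  have hqL : q ∈ L.vertices := snd_mem_vertices hrq
  have hpair : {(p, r), (r, q)} ⊆ L.edges := Set.pair_subset hpr hrq
  have hfst : Prod.fst '' (L.edges \ {(p, r), (r, q)}) = L.vertices \ {p, r} := by
    rw [L.injOn_fst.image_sdiff_subset hpair, Set.image_pair, vertices]
  have hsnd : Prod.snd '' (L.edges \ {(p, r), (r, q)}) = L.vertices \ {r, q} := by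
    rw [L.injOn_snd.image_sdiff_subset hpair, Set.image_pair, image_snd_edges]
  have hmeet : ∀ g ∈ L.edges \ {(p, r), (r, q)}, MeetAtEndpoints (p, q) g := fun g hg =>
    meetAtEndpoints_of_inter_subset hg.1 fun x hx => by
      have hx' := hsep g hg.1 (fun h => hg.2 (Or.inl h)) (fun h => hg.2 (Or.inr h)) hx
      exact ⟨hx', hx'.elim (fun h => h ▸ hpL) fun h => h ▸ hqL⟩
  ofInjOn (insert (p, q) (L.edges \ {(p, r), (r, q)}))
    (L.finite.sdiff.insert _) (Set.insert_nonempty _ _)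
    (by
      rintro e (rfl | he)
      exacts [hpq, L.nondegenerate e he.1])
    (injOn_insert_of_notMem_image (L.injOn_fst.mono Set.sdiff_subset) (by simp [hfst]))
    (injOn_insert_of_notMem_image (L.injOn_snd.mono Set.sdiff_subset) (by simp [hsnd]))
    (by
      ext x
      simp only [Set.image_insert_eq, hfst, hsnd]
      have := L.nondegenerate _ hpr
      have := L.nondegenerate _ hrq
      grind)
    ((L.pairwise_meetAtEndpoints.mono Set.sdiff_subset).insert_of_symm fun g hg _ => hmeet g hg)

end OrientedLink

section LipschitzExtension

variable {E : Type*} [NormedAddCommGroup E] [NormedSpace ℝ E]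

theorem exists_pos_mul_add_le_norm_smul_sub_smul {u w : E} (h : ¬SameRay ℝ u w) :
    ∃ c > 0, ∀ a b : ℝ, 0 ≤ a → 0 ≤ b → c * (a + b) ≤ ‖a • u - b • w‖ := by
  have hcont : Continuous fun s : ℝ => ‖s • u - (1 - s) • w‖ := by fun_prop
  obtain ⟨s, ⟨hs0, hs1⟩, hmin⟩ :=
    isCompact_Icc.exists_isMinOn (Set.nonempty_Icc.2 zero_le_one) hcont.continuousOn
  refine ⟨‖s • u - (1 - s) • w‖, norm_pos_iff.2 fun h0 => h ?_, fun a b ha hb => ?_⟩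
  · rw [sub_eq_zero] at h0
    rcases hs0.eq_or_lt with rfl | hs0
    · simp [show w = 0 by simpa using h0.symm]
    rcases hs1.eq_or_lt with rfl | hs1
    · simp [show u = 0 by simpa using h0]
    exact Or.inr (Or.inr ⟨s, 1 - s, hs0, sub_pos.2 hs1, h0⟩)
  · rcases (add_nonneg ha hb).eq_or_lt with h0 | h0
    · rw [← h0, mul_zero]
      exact norm_nonneg _
    have hmem : a / (a + b) ∈ Set.Icc (0 : ℝ) 1 :=
      ⟨by positivity, (div_le_one h0).2 (by linarith)⟩
    calc ‖s • u - (1 - s) • w‖ * (a + b)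
        ≤ ‖(a / (a + b)) • u - (1 - a / (a + b)) • w‖ * (a + b) := by
          gcongr
          exact hmin hmem
      _ = ‖(a + b) • ((a / (a + b)) • u - (1 - a / (a + b)) • w)‖ := by
        rw [norm_smul, Real.norm_of_nonneg h0.le, mul_comm]
      _ = ‖a • u - b • w‖ := by
        rw [smul_sub, smul_smul, smul_smul, mul_div_cancel₀ _ h0.ne', mul_sub,
          mul_div_cancel₀ _ h0.ne', mul_one, add_sub_cancel_left]

theorem exists_dist_add_dist_le_mul_dist {v a b : E} (h : ¬SameRay ℝ (a - v) (b - v)) :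
    ∃ C : ℝ, ∀ x ∈ segment ℝ v a, ∀ y ∈ segment ℝ v b, dist x v + dist v y ≤ C * dist x y := by
  obtain ⟨c, hc, hle⟩ := exists_pos_mul_add_le_norm_smul_sub_smul h
  refine ⟨(‖a - v‖ + ‖b - v‖) / c, ?_⟩
  rw [segment_eq_image', segment_eq_image']
  rintro _ ⟨s, hs, rfl⟩ _ ⟨t, ht, rfl⟩
  have hst := hle s t hs.1 ht.1
  rw [div_mul_eq_mul_div, le_div_iff₀ hc, dist_self_add_left, dist_self_add_right, dist_eq_norm,
    add_sub_add_left_eq_sub, norm_smul, norm_smul, Real.norm_of_nonneg hs.1,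
    Real.norm_of_nonneg ht.1]
  calc (s * ‖a - v‖ + t * ‖b - v‖) * c ≤ (‖a - v‖ + ‖b - v‖) * (c * (s + t)) := by
        have := mul_nonneg hc.le (mul_nonneg ht.1 (norm_nonneg (a - v)))
        have := mul_nonneg hc.le (mul_nonneg hs.1 (norm_nonneg (b - v)))
        linarith
    _ ≤ (‖a - v‖ + ‖b - v‖) * ‖s • (a - v) - t • (b - v)‖ := by gcongr

theorem exists_dist_le_mul_dist_of_disjoint {X : Type*} [MetricSpace X] {S T : Set X}
    (hS : IsCompact S) (hT : IsCompact T)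
    (hdisj : Disjoint S T) {f g : X → ℝ} (hf : ContinuousOn f S) (hg : ContinuousOn g T) :
    ∃ C : ℝ, ∀ x ∈ S, ∀ y ∈ T, dist (f x) (g y) ≤ C * dist x y := by
  have hpos : ∀ P ∈ S ×ˢ T, 0 < dist P.1 P.2 := fun P hP =>
    dist_pos.2 (hdisj.ne_of_mem hP.1 hP.2)
  have hcont : ContinuousOn (fun P : X × X => dist (f P.1) (g P.2) / dist P.1 P.2) (S ×ˢ T) :=
    (continuous_dist.comp_continuousOn ((hf.comp continuousOn_fst Set.mapsTo_fst_prod).prodMk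
      (hg.comp continuousOn_snd Set.mapsTo_snd_prod))).div continuous_dist.continuousOn
      fun P hP => (hpos P hP).ne'
  obtain ⟨C, hC⟩ := (hS.prod hT).bddAbove_image hcont
  exact ⟨C, fun x hx y hy => (div_le_iff₀ (hpos (x, y) ⟨hx, hy⟩)).1
    (hC (Set.mem_image_of_mem _ (Set.mk_mem_prod hx hy)))⟩

theorem exists_lipschitzWith_eqOn {X ι : Type*} [PseudoMetricSpace X] [Finite ι] {S : ι → Set X}
    {f : ι → X → ℝ}
    (h : ∀ i j, ∃ C : ℝ, ∀ x ∈ S i, ∀ y ∈ S j, dist (f i x) (f j y) ≤ C * dist x y) :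
    ∃ K : NNReal, ∃ g : X → ℝ, LipschitzWith K g ∧ ∀ i, Set.EqOn g (f i) (S i) := by
  classical
  choose C hC using h
  obtain ⟨B, hB⟩ := (Set.finite_range (Function.uncurry C)).bddAbove
  have hCB : ∀ i j, C i j ≤ B := fun i j => hB ⟨(i, j), rfl⟩
  let g₀ : X → ℝ := fun x => if hx : ∃ i, x ∈ S i then f hx.choose x else 0
  have hg₀ : ∀ i, Set.EqOn g₀ (f i) (S i) := fun i x hx => by
    have hx' : ∃ i, x ∈ S i := ⟨i, hx⟩
    refine (dif_pos hx').trans (dist_le_zero.1 ?_)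
    simpa using hC _ _ x hx'.choose_spec x hx
  have hlip : LipschitzOnWith B.toNNReal g₀ (⋃ i, S i) := by
    refine LipschitzOnWith.of_dist_le_mul fun x hx y hy => ?_
    obtain ⟨i, hi⟩ := Set.mem_iUnion.1 hx
    obtain ⟨j, hj⟩ := Set.mem_iUnion.1 hy
    rw [hg₀ i hi, hg₀ j hj]
    refine (hC i j x hi y hj).trans ?_
    gcongr
    exact (hCB i j).trans (Real.le_coe_toNNReal B)
  obtain ⟨g, hg, heq⟩ := hlip.extend_real
  exact ⟨_, g, hg, fun i => (heq.mono (Set.subset_iUnion S i)).symm.trans (hg₀ i)⟩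

theorem lipschitzWith_continuousAffineMap (A : E →ᴬ[ℝ] ℝ) : LipschitzWith ‖A.contLinear‖₊ A :=
  LipschitzWith.of_dist_le_mul fun x y => by
    rw [dist_eq_norm, dist_eq_norm, ← vsub_eq_sub (A x), ← A.contLinear_map_vsub]
    exact A.contLinear.le_opNorm _

theorem exists_continuousAffineMap_apply_eq {a b : E} (hab : a ≠ b) (s t : ℝ) :
    ∃ A : E →ᴬ[ℝ] ℝ, A a = s ∧ A b = t := by
  obtain ⟨ℓ, hℓ⟩ := SeparatingDual.exists_eq_one (R := ℝ) (sub_ne_zero.2 hab.symm)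
  refine ⟨((t - s) • ℓ).toContinuousAffineMap +
    ContinuousAffineMap.const ℝ E (s - (t - s) * ℓ a), ?_, ?_⟩
  · simp
  · have : ℓ b = ℓ a + 1 := by rw [← hℓ, map_sub]; ring
    simp [this]
    ring

theorem isHomeomorph_id_add [CompleteSpace E] {f : E → E} {K : NNReal} (hf : LipschitzWith K f)
    (hK : K < 1) : IsHomeomorph fun x => x + f x := by
  have happrox : ApproximatesLinearOn (fun x => x + f x)
      (ContinuousLinearEquiv.refl ℝ E : E →L[ℝ] E) Set.univ K := fun x _ y _ => by
    have : x + f x - (y + f y) - (ContinuousLinearEquiv.refl ℝ E : E →L[ℝ] E) (x - y) =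
        f x - f y := by
      simp only [ContinuousLinearEquiv.coe_refl, ContinuousLinearMap.id_apply]
      abel
    rw [this]
    exact hf.norm_sub_le x y
  rcases subsingleton_or_nontrivial E with hE | hE
  · exact (happrox.toHomeomorph _ (Or.inl hE)).isHomeomorph
  · refine (happrox.toHomeomorph _ (Or.inr ?_)).isHomeomorph
    have : ‖((ContinuousLinearEquiv.refl ℝ E).symm : E →L[ℝ] E)‖₊ = 1 :=
      NNReal.eq ContinuousLinearMap.norm_id
    rwa [this, inv_one]

end LipschitzExtension

theorem isCompact_edgeSegment (e : R3 × R3) : IsCompact (edgeSegment e) := by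
  rw [edgeSegment, segment_eq_image_lineMap]
  exact isCompact_Icc.image AffineMap.lineMap_continuous

theorem exists_edgeSegment_eq_segment {e : R3 × R3} (he : e.1 ≠ e.2) {v : R3}
    (hv : v ∈ ({e.1, e.2} : Set R3)) :
    ∃ a, a ≠ v ∧ edgeSegment e = segment ℝ v a ∧ ({e.1, e.2} : Set R3) = {v, a} := by
  rcases hv with rfl | rfl
  · exact ⟨e.2, he.symm, rfl, rfl⟩
  · exact ⟨e.1, he, segment_symm ℝ _ _, Set.pair_comm _ _⟩

namespace MeetAtEndpoints

theorem not_sameRay {v a b : R3} (ha : a ≠ v) (hb : b ≠ v)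
    (h : MeetAtEndpoints (v, a) (v, b)) : ¬SameRay ℝ (a - v) (b - v) := by
  intro hray
  -- one of the two segments contains the other, so they share a midpoint
  rcases wbtw_or_wbtw_of_sameRay hray with hw | hw
  · have hmid := midpoint_mem_segment (𝕜 := ℝ) v a
    have hsub := (segment_union_segment_of_wbtw hw).subset (Or.inl hmid)
    rcases (h ⟨hmid, hsub⟩).1 with h' | h'
    exacts [ha ((midpoint_eq_left_iff ℝ).1 h').symm, ha ((midpoint_eq_right_iff ℝ).1 h').symm]
  · have hmid := midpoint_mem_segment (𝕜 := ℝ) v b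
    have hsub := (segment_union_segment_of_wbtw hw).subset (Or.inl hmid)
    rcases (h ⟨hsub, hmid⟩).2 with h' | h'
    exacts [hb ((midpoint_eq_left_iff ℝ).1 h').symm, hb ((midpoint_eq_right_iff ℝ).1 h').symm]

theorem exists_dist_le_mul_dist {e f : R3 × R3} (h : MeetAtEndpoints e f) (he : e.1 ≠ e.2)
    (hf : f.1 ≠ f.2) {A B : R3 →ᴬ[ℝ] ℝ}
    (hAB : ∀ x ∈ edgeSegment e ∩ edgeSegment f, A x = B x) :
    ∃ C : ℝ, ∀ x ∈ edgeSegment e, ∀ y ∈ edgeSegment f, dist (A x) (B y) ≤ C * dist x y := by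
  by_cases hdisj : Disjoint (edgeSegment e) (edgeSegment f)
  · exact exists_dist_le_mul_dist_of_disjoint (isCompact_edgeSegment e) (isCompact_edgeSegment f)
      hdisj A.continuous.continuousOn B.continuous.continuousOn
  · obtain ⟨v, hv⟩ := Set.not_disjoint_iff_nonempty_inter.1 hdisj
    obtain ⟨a, hav, hea, hea'⟩ := exists_edgeSegment_eq_segment he (h hv).1
    obtain ⟨b, hbv, hfb, hfb'⟩ := exists_edgeSegment_eq_segment hf (h hv).2
    have hray : ¬SameRay ℝ (a - v) (b - v) := not_sameRay hav hbv (by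
      rwa [MeetAtEndpoints, hea, hfb, hea', hfb'] at h)
    obtain ⟨C, hC⟩ := exists_dist_add_dist_le_mul_dist hray
    obtain ⟨K, hA, hB⟩ : ∃ K : NNReal, LipschitzWith K A ∧ LipschitzWith K B :=
      ⟨_, (lipschitzWith_continuousAffineMap A).weaken (le_max_left _ _),
        (lipschitzWith_continuousAffineMap B).weaken (le_max_right _ _)⟩
    refine ⟨K * C, fun x hx y hy => ?_⟩
    calc dist (A x) (B y) ≤ dist (A x) (A v) + dist (B v) (B y) := by
          rw [hAB v hv]
          exact dist_triangle _ _ _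
      _ ≤ K * dist x v + K * dist v y := add_le_add (hA.dist_le_mul x v) (hB.dist_le_mul v y)
      _ ≤ K * (C * dist x y) := by
          rw [← mul_add]
          gcongr
          exact hC x (hea ▸ hx) y (hfb ▸ hy)
      _ = K * C * dist x y := (mul_assoc _ _ _).symm

end MeetAtEndpoints

namespace OrientedLink

theorem exists_lipschitz_extension (L : OrientedLink) (φ : R3 → ℝ) :
    ∃ K : NNReal, ∃ g : R3 → ℝ, LipschitzWith K g ∧ (∀ v ∈ L.vertices, g v = φ v) ∧
      ∀ e ∈ L.edges, ∃ A : R3 →ᴬ[ℝ] ℝ, Set.EqOn g A (edgeSegment e) := by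
  have : Finite L.edges := L.finite
  have hA : ∀ e : L.edges, ∃ A : R3 →ᴬ[ℝ] ℝ, A e.1.1 = φ e.1.1 ∧ A e.1.2 = φ e.1.2 := fun e =>
    exists_continuousAffineMap_apply_eq (L.nondegenerate _ e.2) _ _
  choose A hA using hA
  have hendpoint : ∀ (e : L.edges), ∀ x ∈ ({e.1.1, e.1.2} : Set R3), A e x = φ x := by
    rintro e x (rfl | rfl)
    exacts [(hA e).1, (hA e).2]
  obtain ⟨K, g, hg, heq⟩ := exists_lipschitzWith_eqOn (S := fun e : L.edges => edgeSegment e.1)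
    (f := fun e => A e) fun e f => by
      by_cases hef : e = f
      · subst hef
        exact ⟨_, fun x _ y _ => (lipschitzWith_continuousAffineMap (A e)).dist_le_mul x y⟩
      · have hmeet := L.pairwise_meetAtEndpoints e.2 f.2 (Subtype.coe_ne_coe.2 hef)
        exact hmeet.exists_dist_le_mul_dist (L.nondegenerate _ e.2) (L.nondegenerate _ f.2)
          fun x hx => (hendpoint e x (hmeet hx).1).trans (hendpoint f x (hmeet hx).2).symm
  refine ⟨K, g, hg, ?_, fun e he => ⟨A ⟨e, he⟩, heq ⟨e, he⟩⟩⟩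
  rintro _ ⟨e, he, rfl⟩
  exact (heq ⟨e, he⟩ (left_mem_segment ℝ _ _)).trans (hA ⟨e, he⟩).1

/-- Isotopy types of links. The quotient by the relation generated by isotopy saves proving that
isotopy is transitive, which would need common subdivisions. -/
def LinkType : Type := Quot Isotopic

/-- The isotopy type of a link. -/
def linkType (L : OrientedLink) : LinkType := Quot.mk _ L

theorem Isotopic.linkType_eq {L M : OrientedLink} (h : L.Isotopic M) : L.linkType = M.linkType :=
  Quot.sound h

theorem Refines.refl (L : OrientedLink) : L.Refines L :=
  ⟨rfl, fun e he => ⟨e, he, subset_rfl, 1, one_pos, (one_smul _ _).symm⟩⟩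

theorem Refines.isotopic {L M : OrientedLink} (h : M.Refines L) : M.Isotopic L :=
  ⟨M, M, .refl M, h, fun P => P.2, ⟨continuous_snd, fun _ => .id, fun _ => rfl⟩, by simp, by simp⟩

theorem isotopic_map (L : OrientedLink) {H : unitInterval × R3 → R3} (hH : IsAmbientIsotopy H)
    (hseg : ∀ e ∈ L.edges,
      (fun p => H (1, p)) '' edgeSegment e = edgeSegment (H (1, e.1), H (1, e.2))) :
    L.Isotopic (L.map (fun p => H (1, p)) (hH.2.1 1).injective hseg) :=
  ⟨L, _, .refl _, .refl _, H, hH, rfl, hseg⟩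

end OrientedLink

theorem image_edgeSegment_of_eqOn {φ : R3 → R3} {Φ : R3 →ᵃ[ℝ] R3} {e : R3 × R3}
    (h : Set.EqOn φ Φ (edgeSegment e)) : φ '' edgeSegment e = edgeSegment (φ e.1, φ e.2) := by
  rw [h.image_eq, edgeSegment, image_segment, edgeSegment, h (left_mem_segment ℝ _ _),
    h (right_mem_segment ℝ _ _)]

theorem isAmbientIsotopy_add_smul {g : R3 → ℝ} {K : NNReal} (hg : LipschitzWith K g) {w : R3}
    (hw : K * ‖w‖₊ < 1) : IsAmbientIsotopy fun P => P.2 + g P.2 • ((P.1 : ℝ) • w) := by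
  have := hg.continuous
  refine ⟨by fun_prop, fun t => isHomeomorph_id_add (K := K * ‖w‖₊) ?_ hw, fun p => by simp⟩
  refine LipschitzWith.of_dist_le_mul fun x y => ?_
  calc dist (g x • ((t : ℝ) • w)) (g y • ((t : ℝ) • w))
      = dist (g x) (g y) * (t * ‖w‖) := by
        rw [dist_eq_norm, ← sub_smul, norm_smul, norm_smul, Real.norm_of_nonneg t.2.1,
          Real.dist_eq, Real.norm_eq_abs]
    _ ≤ K * dist x y * (1 * ‖w‖) := by
        gcongr
        exacts [mul_nonneg t.2.1 (norm_nonneg w), hg.dist_le_mul x y, t.2.2]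
    _ = (K * ‖w‖₊ : NNReal) * dist x y := by
        rw [NNReal.coe_mul, coe_nnnorm]
        ring

namespace OrientedLink

theorem eventually_exists_isotopic_update [DecidableEq R3] (L : OrientedLink) (v : R3) :
    ∀ᶠ w in nhds v, ∃ M : OrientedLink, L.Isotopic M ∧
      M.edges = Prod.map (Function.update id v w) (Function.update id v w) '' L.edges := by
  obtain ⟨K, g, hg, hgv, haff⟩ := L.exists_lipschitz_extension (Pi.single v 1)
  have hsmall : ∀ᶠ w in nhds v, K * ‖w - v‖₊ < 1 := by
    have : Continuous fun w : R3 => K * ‖w - v‖₊ := by fun_prop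
    exact this.continuousAt.eventually_lt_const (by simp)
  filter_upwards [hsmall] with w hw
  have hH := isAmbientIsotopy_add_smul hg hw
  refine ⟨_, L.isotopic_map hH fun e he => ?_, ?_⟩
  · obtain ⟨A, hA⟩ := haff e he
    let Φ : R3 →ᵃ[ℝ] R3 := AffineMap.id ℝ R3 + (lineMap 0 (w - v)).comp A.toAffineMap
    exact image_edgeSegment_of_eqOn (Φ := Φ) fun p hp => by simp [Φ, hA hp, lineMap_apply]
  · have hvertex : ∀ u ∈ L.vertices,
        u + g u • (((1 : unitInterval) : ℝ) • (w - v)) = Function.update id v w u := by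
      intro u hu
      rcases eq_or_ne u v with rfl | hne
      · simp [hgv u hu]
      · simp [hgv u hu, hne]
    exact Set.image_congr fun e he =>
      Prod.ext (hvertex _ (fst_mem_vertices he)) (hvertex _ (snd_mem_vertices he))

theorem support_eq_of_wbtw {L : OrientedLink} {p q r : R3} (hpq : (p, q) ∈ L.edges)
    (hr : Wbtw ℝ p r q) {M : OrientedLink}
    (hM : M.edges = insert (p, r) (insert (r, q) (L.edges \ {(p, q)}))) :
    M.support = L.support := by
  rw [support, support, hM, ← Set.insert_sdiff_self_of_mem hpq]
  simp only [Set.biUnion_insert, ← Set.union_assoc]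
  rw [edgeSegment, edgeSegment, segment_union_segment_of_wbtw hr, edgeSegment]
  simp

theorem refines_of_wbtw {L M : OrientedLink} {p q r : R3} (hpq : (p, q) ∈ L.edges)
    (hr : Wbtw ℝ p r q) (hM : M.edges = insert (p, r) (insert (r, q) (L.edges \ {(p, q)}))) :
    M.Refines L := by
  refine ⟨support_eq_of_wbtw hpq hr hM, ?_⟩
  have hunion := segment_union_segment_of_wbtw hr
  have hpr : p ≠ r := M.nondegenerate (p, r) (by simp [hM])
  have hrq : r ≠ q := M.nondegenerate (r, q) (by simp [hM])
  obtain ⟨s, ⟨hs0, hs1⟩, rfl⟩ := hr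
  rw [hM]
  rintro e (rfl | rfl | he)
  · refine ⟨_, hpq, Set.subset_union_left.trans hunion.subset, s, hs0.lt_of_ne ?_, ?_⟩
    · rintro rfl
      simp at hpr
    · simp [lineMap_apply]
  · refine ⟨_, hpq, Set.subset_union_right.trans hunion.subset, 1 - s,
      sub_pos.2 (hs1.lt_of_ne ?_), ?_⟩
    · rintro rfl
      simp at hrq
    · simp only [lineMap_apply, vsub_eq_sub, vadd_eq_add]
      module
  · exact ⟨e, he.1, subset_rfl, 1, one_pos, (one_smul _ _).symm⟩

theorem eventually_exists_move_vertex {L : OrientedLink} {p q r : R3} {E : Set (R3 × R3)}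
    (hL : L.edges = insert (p, r) (insert (r, q) E)) (hpr : (p, r) ∉ E) (hrq : (r, q) ∉ E) :
    ∀ᶠ w in nhds r, ∃ M : OrientedLink,
      M.edges = insert (p, w) (insert (w, q) E) ∧ M.linkType = L.linkType := by
  classical
  have hprL : (p, r) ∈ L.edges := by simp [hL]
  have hrqL : (r, q) ∈ L.edges := by simp [hL]
  have hsub : E ⊆ L.edges := hL ▸ (Set.subset_insert _ _).trans (Set.subset_insert _ _)
  filter_upwards [L.eventually_exists_isotopic_update r] with w ⟨M, hiso, hM⟩
  refine ⟨M, ?_, hiso.linkType_eq.symm⟩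
  have hfix : ∀ e ∈ E, Prod.map (Function.update id r w) (Function.update id r w) e = e :=
    fun e he => by
      have h₁ : e.1 ≠ r := fun h => hrq (L.injOn_fst (hsub he) hrqL h ▸ he)
      have h₂ : e.2 ≠ r := fun h => hpr (L.injOn_snd (hsub he) hprL h ▸ he)
      simp [Prod.map, h₁, h₂]
  have hpr' : p ≠ r := L.nondegenerate _ hprL
  have hrq' : q ≠ r := (L.nondegenerate _ hrqL).symm
  rw [hM, hL, Set.image_insert_eq, Set.image_insert_eq, Set.image_congr hfix]
  simp [Function.update_of_ne hpr', Function.update_of_ne hrq']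

theorem exists_triangle_split {L : OrientedLink} {p q r : R3} {E : Set (R3 × R3)}
    (hL : L.edges = insert (p, q) E) (hE : (p, q) ∉ E) (hp : p ∉ segment ℝ r q)
    (hq : q ∉ segment ℝ p r)
    (htri : ∀ g ∈ E, convexHull ℝ {p, q, r} ∩ edgeSegment g ⊆ {p, q}) :
    ∃ M : OrientedLink, M.edges = insert (p, r) (insert (r, q) E) ∧
      M.linkType = L.linkType := by
  have hpq : (p, q) ∈ L.edges := hL ▸ Or.inl rfl
  obtain rfl : L.edges \ {(p, q)} = E := by rw [hL, Set.insert_sdiff_self_of_notMem hE]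
  have hne : p ≠ q := L.nondegenerate _ hpq
  have hmid : Wbtw ℝ p (midpoint ℝ p q) q := wbtw_midpoint ℝ p q
  let m : unitInterval → R3 := fun s => lineMap (midpoint ℝ p q) r s.1
  have hpm : ∀ s, p ∉ segment ℝ (m s) q := fun s =>
    notMem_segment_lineMap_of_wbtw hmid (mt (left_eq_midpoint_iff ℝ).1 hne) hp s.2
  have hqm : ∀ s, q ∉ segment ℝ p (m s) := fun s => by
    rw [segment_symm] at hq ⊢
    exact notMem_segment_lineMap_of_wbtw hmid.symm (mt (right_eq_midpoint_iff ℝ).1 hne) hq s.2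
  have hmem : ∀ s, m s ∈ convexHull ℝ {p, q, r} := fun s =>
    (convex_convexHull ℝ _).lineMap_mem
      (segment_subset_convexHull (by simp) (by simp) (midpoint_mem_segment p q))
      (subset_convexHull ℝ _ (by simp)) s.2
  let F : unitInterval → OrientedLink := fun s => L.splitEdge hpq (m s) (hpm s) (hqm s)
    fun g hg hgne => (Set.inter_subset_inter_left _
      (segment_union_segment_subset_convexHull (hmem s))).trans (htri g ⟨hg, hgne⟩)
  have hF : ∀ s, (F s).edges = insert (p, m s) (insert (m s, q) (L.edges \ {(p, q)})) :=
    fun _ => rfl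
  have hmL : ∀ s, m s ∉ L.vertices := fun s =>
    have ⟨_, hpr, hrq⟩ := pairwise_ne_of_notMem_segment (hpm s) (hqm s)
    notMem_vertices_of_mem_edgeSegment hpr hrq fun g hg hgne h => htri g ⟨hg, hgne⟩ ⟨hmem s, h⟩
  have hm : Continuous m := AffineMap.lineMap_continuous.comp continuous_subtype_val
  have hconst : IsLocallyConstant fun s => (F s).linkType :=
    (IsLocallyConstant.iff_eventually_eq _).2 fun s =>
      (hm.continuousAt.eventually (eventually_exists_move_vertex (hF s)
        (fun h => hmL s (snd_mem_vertices h.1)) fun h => hmL s (fst_mem_vertices h.1))).mono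
        fun t ⟨M, hM, hMF⟩ => by rw [← hMF, eq_of_edges_eq (hM.trans (hF t).symm)]
  have hm0 : m 0 = midpoint ℝ p q := AffineMap.lineMap_apply_zero _ _
  have hm1 : m 1 = r := AffineMap.lineMap_apply_one _ _
  refine ⟨F 1, by rw [hF, hm1], ?_⟩
  calc (F 1).linkType = (F 0).linkType := hconst.apply_eq_of_preconnectedSpace 1 0
    _ = L.linkType :=
      (refines_of_wbtw hpq hmid (by rw [hF, hm0])).isotopic.linkType_eq

theorem exists_triangle_merge {L : OrientedLink} {p q r : R3} {E : Set (R3 × R3)}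
    (hL : L.edges = insert (p, r) (insert (r, q) E)) (hprE : (p, r) ∉ E) (hrqE : (r, q) ∉ E)
    (hp : p ∉ segment ℝ r q) (hq : q ∉ segment ℝ p r)
    (htri : ∀ g ∈ E, convexHull ℝ {p, q, r} ∩ edgeSegment g ⊆ {p, q}) :
    ∃ M : OrientedLink, M.edges = insert (p, q) E ∧ M.linkType = L.linkType := by
  have hpr : (p, r) ∈ L.edges := hL ▸ Or.inl rfl
  have hrq : (r, q) ∈ L.edges := hL ▸ Or.inr (Or.inl rfl)
  obtain ⟨hpq, -, hrq'⟩ := pairwise_ne_of_notMem_segment hp hq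
  have hrest : L.edges \ {(p, r), (r, q)} = E := by
    rw [hL, ← Set.singleton_union, ← Set.insert_eq, Set.insert_eq (p, r), Set.insert_eq (r, q),
      ← Set.union_assoc, ← Set.insert_eq, Set.union_sdiff_cancel_left]
    rintro e ⟨rfl | rfl, he⟩
    exacts [hprE he, hrqE he]
  have hsub : segment ℝ p q ⊆ convexHull ℝ {p, q, r} :=
    segment_subset_convexHull (by simp) (by simp)
  let M := L.mergeEdges hpr hrq hpq fun g hg hg₁ hg₂ =>
    (Set.inter_subset_inter_left _ hsub).trans (htri g (hrest ▸ ⟨hg, by simp [hg₁, hg₂]⟩))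
  have hM : M.edges = insert (p, q) E := hrest ▸ rfl
  have hpqE : (p, q) ∉ E := fun h =>
    hrq' (congrArg Prod.snd (L.injOn_fst hpr (x₂ := (p, q)) (by simp [hL, h]) rfl))
  obtain ⟨N, hN, hNM⟩ := exists_triangle_split hM hpqE hp hq htri
  have hNL : N = L := eq_of_edges_eq (hN.trans hL.symm)
  exact ⟨M, hM, by rw [← hNM, hNL]⟩

theorem exists_subdivide {L : OrientedLink} {p q r : R3} {E : Set (R3 × R3)}
    (hL : L.edges = insert (p, q) E) (hE : (p, q) ∉ E) (hr : Sbtw ℝ p r q) :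
    ∃ M : OrientedLink, M.edges = insert (p, r) (insert (r, q) E) ∧
      M.linkType = L.linkType := by
  have hpq : (p, q) ∈ L.edges := hL ▸ Or.inl rfl
  obtain ⟨hw, hrp, hrq⟩ := hr
  have hp : p ∉ segment ℝ r q := fun h =>
    hrp ((mem_segment_iff_wbtw.1 h).swap_left_iff.1 hw)
  have hq : q ∉ segment ℝ p r := fun h => hrq (hw.swap_right_iff.1 (mem_segment_iff_wbtw.1 h))
  refine exists_triangle_split hL hE hp hq fun g hg => ?_
  have hhull : convexHull ℝ {p, q, r} ⊆ edgeSegment (p, q) := convexHull_min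
    (by
      rintro x (rfl | rfl | rfl)
      exacts [left_mem_segment ℝ _ _, right_mem_segment ℝ _ _, hw.mem_segment])
    (convex_segment p q)
  exact (Set.inter_subset_inter_left _ hhull).trans ((L.embedded _ hpq g (hL ▸ Or.inr hg)
    (ne_of_mem_of_not_mem hg hE).symm).trans Set.inter_subset_left)

end OrientedLink

section Segments

variable {E : Type*} [AddCommGroup E] [Module ℝ E]

theorem exists_sbtw_eq {ℓ : E →ₗ[ℝ] ℝ} {a b : E} {c : ℝ} (ha : ℓ a < c) (hb : c < ℓ b) :
    ∃ x, Sbtw ℝ a x b ∧ ℓ x = c := by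
  obtain ⟨x, hx, rfl⟩ : c ∈ ℓ '' openSegment ℝ a b := by
    have himage : ℓ '' openSegment ℝ a b = openSegment ℝ (ℓ a) (ℓ b) :=
      image_openSegment ℝ ℓ.toAffineMap a b
    rw [himage, openSegment_eq_Ioo (ha.trans hb)]
    exact ⟨ha, hb⟩
  have hx' : Wbtw ℝ a x b := mem_segment_iff_wbtw.1 (openSegment_subset_segment ℝ a b hx)
  refine ⟨x, ⟨hx', ?_, ?_⟩, rfl⟩
  · rintro rfl
    exact ha.false
  · rintro rfl
    exact hb.false

theorem eq_right_of_mem_segment {ℓ : E →ₗ[ℝ] ℝ} {a b x : E} (hx : x ∈ segment ℝ a b)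
    (hab : ℓ a < ℓ b) (hbx : ℓ b ≤ ℓ x) : x = b := by
  rw [segment_eq_image_lineMap] at hx
  obtain ⟨s, ⟨-, hs⟩, rfl⟩ := hx
  have hℓ : ℓ (lineMap a b s) = ℓ b - (1 - s) * (ℓ b - ℓ a) := by
    simp only [lineMap_apply, vsub_eq_sub, vadd_eq_add, map_add, map_smul, map_sub, smul_eq_mul]
    ring
  obtain rfl : s = 1 := by
    nlinarith
  exact AffineMap.lineMap_apply_one a b

end Segments

/-- An edge lies in the half-space `ℓ ≤ c` and meets the plane `ℓ = c` at most in `S`. -/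
def LiesBelow (ℓ : R3 →ₗ[ℝ] ℝ) (c : ℝ) (S : Set R3) (e : R3 × R3) : Prop :=
  ∀ x ∈ edgeSegment e, ℓ x ≤ c ∧ (ℓ x = c → x ∈ S)

theorem LiesBelow.mono {ℓ : R3 →ₗ[ℝ] ℝ} {c : ℝ} {S T : Set R3} {e : R3 × R3}
    (h : LiesBelow ℓ c S e) (hST : S ⊆ T) : LiesBelow ℓ c T e :=
  fun x hx => ⟨(h x hx).1, fun hxc => hST ((h x hx).2 hxc)⟩

theorem liesBelow_of_lt {ℓ : R3 →ₗ[ℝ] ℝ} {c : ℝ} {e : R3 × R3} (h₁ : ℓ e.1 < c) (h₂ : ℓ e.2 < c)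
    (S : Set R3) : LiesBelow ℓ c S e := fun x hx =>
  have hxc : ℓ x < c := (convex_halfSpace_lt ℓ.isLinear c).segment_subset h₁ h₂ hx
  ⟨hxc.le, fun h => absurd h hxc.ne⟩

theorem liesBelow_singleton {ℓ : R3 →ₗ[ℝ] ℝ} {a b : R3} (h : ℓ a < ℓ b) :
    LiesBelow ℓ (ℓ b) {b} (a, b) := fun _ hx =>
  ⟨(convex_halfSpace_le ℓ.isLinear (ℓ b)).segment_subset h.le (le_refl (ℓ b)) hx,
    fun hxb => eq_right_of_mem_segment hx h hxb.ge⟩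

theorem LiesBelow.swap {ℓ : R3 →ₗ[ℝ] ℝ} {c : ℝ} {S : Set R3} {e : R3 × R3}
    (h : LiesBelow ℓ c S e) : LiesBelow ℓ c S e.swap :=
  fun x hx => h x (by rwa [edgeSegment, segment_symm])

namespace OrientedLink

theorem exists_triangle_merge_of_slab {L : OrientedLink} {E : Set (R3 × R3)} {p m q : R3}
    {ℓ : R3 →ₗ[ℝ] ℝ} {c : ℝ} (hL : L.edges = insert (p, m) (insert (m, q) E)) (hpq : p ≠ q)
    (hp : ℓ p = c) (hq : ℓ q = c) (hm : c < ℓ m)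
    (hE : ∀ g ∈ E, ∀ x ∈ edgeSegment g, c ≤ ℓ x → ℓ x ≤ ℓ m → x = p ∨ x = q) :
    ∃ M : OrientedLink, M.edges = insert (p, q) E ∧ M.linkType = L.linkType := by
  have hmE : ∀ g : R3 × R3, m ∈ edgeSegment g → g ∉ E := fun g hmg hg => by
    rcases hE g hg m hmg hm.le le_rfl with rfl | rfl <;> linarith
  have hneg : (-ℓ) m < -c := neg_lt_neg hm
  refine exists_triangle_merge hL (hmE _ (right_mem_segment ℝ _ _))
    (hmE _ (left_mem_segment ℝ _ _))
    (fun h => hpq (eq_right_of_mem_segment (ℓ := -ℓ) h (by simpa [hq] using hneg)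
      (by simp [hp, hq])))
    (fun h => hpq (eq_right_of_mem_segment (ℓ := -ℓ) (segment_symm ℝ p m ▸ h)
      (by simpa [hp] using hneg) (by simp [hp, hq])).symm)
    fun g hg x ⟨hx, hxg⟩ => hE g hg x hxg
      (convexHull_min (by simp [Set.insert_subset_iff, hp, hq, hm.le])
        (convex_halfSpace_ge ℓ.isLinear c) hx)
      (convexHull_min (by simp [Set.insert_subset_iff, hp, hq, hm.le])
        (convex_halfSpace_le ℓ.isLinear (ℓ m)) hx)

theorem exists_truncate {L : OrientedLink} {E : Set (R3 × R3)} {p₀ m q₀ : R3}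
    {ℓ : R3 →ₗ[ℝ] ℝ} {c : ℝ} (hL : L.edges = insert (p₀, m) (insert (m, q₀) E))
    (hp₀ : ℓ p₀ < c) (hq₀ : ℓ q₀ < c) (hm : c < ℓ m)
    (hE : ∀ g ∈ E, ∀ x ∈ edgeSegment g, ℓ x < c ∨ ℓ m < ℓ x) :
    ∃ (M : OrientedLink) (p q : R3), M.linkType = L.linkType ∧ ℓ p = c ∧ ℓ q = c ∧
      M.edges = insert (p, q) (insert (p₀, p) (insert (q, q₀) E)) := by
  obtain ⟨p, hp, hpc⟩ := exists_sbtw_eq hp₀ hm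
  obtain ⟨q, hq, hqc⟩ := exists_sbtw_eq hq₀ hm
  let E' := insert (q, q₀) (insert (p₀, p) E)
  have hslab : ∀ g ∈ E', ∀ x ∈ edgeSegment g, c ≤ ℓ x → ℓ x ≤ ℓ m → x = p ∨ x = q := by
    rintro g (rfl | rfl | hg) x hx hcx hxm
    · rw [edgeSegment, segment_symm] at hx
      refine Or.inr (eq_right_of_mem_segment (ℓ := ℓ) hx ?_ ?_) <;> linarith
    · refine Or.inl (eq_right_of_mem_segment (ℓ := ℓ) hx ?_ ?_) <;> linarith
    · exact ((hE g hg x hx).elim hcx.not_gt hxm.not_gt).elim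
  have hmE' : ∀ g : R3 × R3, m ∈ edgeSegment g → g ∉ E' := fun g hmg hg => by
    rcases hslab g hg m hmg hm.le le_rfl with rfl | rfl <;> linarith
  have hE' : E ⊆ E' := (Set.subset_insert _ _).trans (Set.subset_insert _ _)
  have hp₀m : (p₀, m) ∉ insert (m, q₀) E := by
    rintro (h | h)
    · exact (hp₀.trans hm).ne (congrArg (fun e : R3 × R3 => ℓ e.1) h)
    · exact hmE' _ (right_mem_segment ℝ _ _) (hE' h)
  obtain ⟨M₁, hM₁, hM₁L⟩ := exists_subdivide hL hp₀m hp
  have hmq₀ : (m, q₀) ∉ insert (p₀, p) (insert (p, m) E) := by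
    rintro (h | h | h)
    · exact (hp₀.trans hm).ne' (congrArg (fun e : R3 × R3 => ℓ e.1) h)
    · exact (hpc ▸ hm).ne' (congrArg (fun e : R3 × R3 => ℓ e.1) h)
    · exact hmE' _ (left_mem_segment ℝ _ _) (hE' h)
  obtain ⟨M₂, hM₂, hM₂L⟩ := exists_subdivide
    (hM₁.trans (by rw [Set.insert_comm (p, m), Set.insert_comm (p₀, p)])) hmq₀ hq.symm
  have hM₂' : M₂.edges = insert (p, m) (insert (m, q) E') := by
    rw [hM₂, Set.insert_comm (p₀, p), Set.insert_comm (q, q₀), Set.insert_comm (m, q)]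
  have hpq : p ≠ q := by
    rintro rfl
    have h : (p₀, p) = (m, p) := M₂.injOn_snd (by simp [hM₂', E']) (by simp [hM₂']) rfl
    exact (hp₀.trans hm).ne (congrArg (fun e : R3 × R3 => ℓ e.1) h)
  obtain ⟨M, hM, hML⟩ := exists_triangle_merge_of_slab hM₂' hpq hpc hqc hm hslab
  refine ⟨M, p, q, hML.trans (hM₂L.trans hM₁L), hpc, hqc, ?_⟩
  rw [hM, Set.insert_comm (p₀, p)]

theorem exists_raise {L : OrientedLink} {A B : Set (R3 × R3)} {ℓ : R3 →ₗ[ℝ] ℝ} {v : R3}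
    (hv : 0 < ℓ v) (hL : L.edges = A ∪ B) (hA₀ : A.Nonempty)
    (hA : ∀ e ∈ A, ℓ e.1 < 0 ∧ ℓ e.2 < 0) (hB : ∀ e ∈ B, 0 < ℓ e.1 ∧ 0 < ℓ e.2) :
    ∃ (M : OrientedLink) (A' : Set (R3 × R3)) (p m q : R3) (c : ℝ), M.linkType = L.linkType ∧
      M.edges = insert (p, m) (insert (m, q) (A' ∪ B)) ∧ c < ℓ m ∧ ℓ m < 0 ∧ ℓ p < c ∧ ℓ q < c ∧
      ∀ e ∈ A', ℓ e.1 < c ∧ ℓ e.2 < c := by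
  have hAL : A ⊆ L.edges := hL ▸ Set.subset_union_left
  obtain ⟨⟨m, q⟩, hmq, hmax⟩ :=
    Set.exists_max_image A (fun e => ℓ e.1) (L.finite.subset hAL) hA₀
  have hmax₂ : ∀ e ∈ A, ℓ e.2 ≤ ℓ m := fun e he => by
    obtain ⟨f, ⟨hf, hfe⟩, -⟩ := L.next e (hAL he)
    rw [hL] at hf
    refine hfe ▸ hmax f (hf.resolve_right fun hfB => ?_)
    exact (hB f hfB).1.not_gt (hfe ▸ (hA e he).2)
  obtain ⟨⟨p, m'⟩, ⟨hpm, rfl⟩, -⟩ := L.prev _ (hAL hmq)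
  replace hpm : (p, m') ∈ A := (hL ▸ hpm : (p, m') ∈ A ∪ B).resolve_right fun h =>
    (hB _ h).2.not_gt (hA _ hmq).1
  have hE : insert (p, m') (insert (m', q) (L.edges \ {(p, m'), (m', q)})) = L.edges := by
    rw [← Set.singleton_union, ← Set.singleton_union, ← Set.union_assoc, ← Set.insert_eq,
      Set.union_sdiff_cancel (Set.pair_subset (hAL hpm) (hAL hmq))]
  have hB' : B \ {(p, m'), (m', q)} = B := sdiff_eq_left.2 <| Set.disjoint_right.2 <| by
    rintro e (rfl | rfl) he
    exacts [(hB _ he).2.not_gt (hA _ hpm).2, (hB _ he).1.not_gt (hA _ hmq).1]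
  have hpos : ∀ᶠ s : ℝ in nhdsWithin 0 (Set.Ioi 0), 0 < s := eventually_mem_nhdsWithin
  have hcont : Filter.Tendsto (fun s : ℝ => m' + s • v) (nhdsWithin 0 (Set.Ioi 0)) (nhds m') := by
    have : Continuous fun s : ℝ => m' + s • v := by fun_prop
    simpa using (this.tendsto 0).mono_left nhdsWithin_le_nhds
  have hneg : ∀ᶠ w in nhds m', ℓ w < 0 :=
    ℓ.continuous_of_finiteDimensional.continuousAt.eventually_lt_const (hA _ hmq).1
  obtain ⟨s, hs, hs₀, M, hM, hML⟩ := (hpos.and (hcont.eventually (hneg.and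
    (eventually_exists_move_vertex hE.symm (by simp) (by simp))))).exists
  have hlt : ℓ m' < ℓ m' + s * ℓ v / 2 := by
    linarith [mul_pos hs hv]
  refine ⟨M, A \ {(p, m'), (m', q)}, p, m' + s • v, q, ℓ m' + s * ℓ v / 2, hML, ?_, ?_, hs₀,
    (hmax _ hpm).trans_lt hlt, (hmax₂ _ hmq).trans_lt hlt,
    fun e he => ⟨(hmax _ he.1).trans_lt hlt, (hmax₂ _ he.1).trans_lt hlt⟩⟩
  · rw [hM, hL, Set.union_sdiff_distrib, hB']
  · rw [map_add, map_smul, smul_eq_mul]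
    linarith [mul_pos hs hv]

theorem exists_extreme_edge {L : OrientedLink} {A B : Set (R3 × R3)} {ℓ : R3 →ₗ[ℝ] ℝ} {v : R3}
    (hv : 0 < ℓ v) (hL : L.edges = A ∪ B) (hA₀ : A.Nonempty)
    (hA : ∀ e ∈ A, ℓ e.1 < 0 ∧ ℓ e.2 < 0) (hB : ∀ e ∈ B, 0 < ℓ e.1 ∧ 0 < ℓ e.2) :
    ∃ (M : OrientedLink) (A' : Set (R3 × R3)) (p q : R3) (c : ℝ), M.linkType = L.linkType ∧
      c < 0 ∧ ℓ p = c ∧ ℓ q = c ∧ M.edges = insert (p, q) (A' ∪ B) ∧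
      ∀ e ∈ A', LiesBelow ℓ c {p, q} e := by
  obtain ⟨L', A', p₀, m, q₀, c, hL'L, hL', hcm, hm, hp₀, hq₀, hA'⟩ := exists_raise hv hL hA₀ hA hB
  obtain ⟨M, p, q, hML', hp, hq, hM⟩ := exists_truncate hL' hp₀ hq₀ hcm <| by
    rintro g (hg | hg) x hx
    · exact Or.inl ((convex_halfSpace_lt ℓ.isLinear c).segment_subset (hA' g hg).1 (hA' g hg).2 hx)
    · exact Or.inr (hm.trans ((convex_halfSpace_gt ℓ.isLinear 0).segment_subset
        (hB g hg).1 (hB g hg).2 hx))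
  refine ⟨M, insert (p₀, p) (insert (q, q₀) A'), p, q, c, hML'.trans hL'L, hcm.trans hm, hp, hq,
    by rw [hM, Set.insert_union, Set.insert_union], ?_⟩
  rintro e (rfl | rfl | he)
  · exact hp ▸ (liesBelow_singleton (hp ▸ hp₀)).mono (by simp)
  · exact hq ▸ ((liesBelow_singleton (hq ▸ hq₀)).swap).mono (by simp)
  · exact liesBelow_of_lt (hA' e he).1 (hA' e he).2 _

theorem exists_extreme_edges {L : OrientedLink} {A B : Set (R3 × R3)} {ℓ : R3 →ₗ[ℝ] ℝ}
    (hL : L.edges = A ∪ B) (hA₀ : A.Nonempty) (hB₀ : B.Nonempty)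
    (hA : ∀ e ∈ A, ℓ e.1 < 0 ∧ ℓ e.2 < 0) (hB : ∀ e ∈ B, 0 < ℓ e.1 ∧ 0 < ℓ e.2) :
    ∃ (M : OrientedLink) (E : Set (R3 × R3)) (p q p' q' : R3) (c d : ℝ),
      M.linkType = L.linkType ∧ c < d ∧ ℓ p = c ∧ ℓ q = c ∧ ℓ p' = d ∧ ℓ q' = d ∧
      M.edges = insert (p, q) (insert (p', q') E) ∧
      ∀ e ∈ E, LiesBelow ℓ c {p, q} e ∨ LiesBelow (-ℓ) (-d) {p', q'} e := by
  obtain ⟨e, he⟩ := hB₀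
  obtain ⟨L', A', p, q, c, hL'L, hc, hp, hq, hL', hA'⟩ :=
    exists_extreme_edge (hB e he).1 hL hA₀ hA hB
  obtain ⟨e', he'⟩ := hA₀
  obtain ⟨M, B', p', q', d, hML', hd, hp', hq', hM, hB'⟩ :=
    exists_extreme_edge (ℓ := -ℓ) (v := e'.1) (A := B) (B := insert (p, q) A')
      (neg_pos.2 (hA e' he').1) (by rw [hL', Set.union_insert, Set.union_comm]) ⟨e, he⟩
      (fun e he => ⟨neg_neg_of_pos (hB e he).1, neg_neg_of_pos (hB e he).2⟩) <| by
        simp only [LinearMap.neg_apply, Left.neg_pos_iff]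
        rintro e (rfl | he)
        · exact ⟨hp.trans_lt hc, hq.trans_lt hc⟩
        · exact ⟨(hA' e he _ (left_mem_segment ℝ _ _)).1.trans_lt hc,
            (hA' e he _ (right_mem_segment ℝ _ _)).1.trans_lt hc⟩
  refine ⟨M, A' ∪ B', p, q, p', q', c, -d, hML'.trans hL'L, hc.trans (neg_pos.2 hd), hp, hq,
    neg_eq_iff_eq_neg.1 hp', neg_eq_iff_eq_neg.1 hq', ?_, ?_⟩
  · rw [hM, Set.union_insert, Set.insert_comm, Set.union_comm]
  · rw [neg_neg]
    rintro e (he | he)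
    exacts [Or.inl (hA' e he), Or.inr (hB' e he)]

end OrientedLink

section Transition

variable {V : Type*} [NormedAddCommGroup V] [NormedSpace ℝ V]

/-- The continuous function that is constantly `u` to the left of `c`, constantly `w` to the right
of `d`, and affine in between. -/
noncomputable def transition (c d : ℝ) (u w : V) (x : ℝ) : V :=
  lineMap u w (max 0 (min 1 ((x - c) / (d - c))))

theorem continuous_transition (c d : ℝ) (u w : V) : Continuous (transition c d u w) :=
  AffineMap.lineMap_continuous.comp (by fun_prop)

theorem transition_of_le {c d : ℝ} (h : c < d) (u w : V) {x : ℝ} (hx : x ≤ c) :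
    transition c d u w x = u := by
  have : (x - c) / (d - c) ≤ 0 := div_nonpos_of_nonpos_of_nonneg (by linarith) (by linarith)
  rw [transition, max_eq_left ((min_le_right _ _).trans this), AffineMap.lineMap_apply_zero]

theorem transition_of_ge {c d : ℝ} (h : c < d) (u w : V) {x : ℝ} (hx : d ≤ x) :
    transition c d u w x = w := by
  have : 1 ≤ (x - c) / (d - c) := (one_le_div (by linarith)).2 (by linarith)
  rw [transition, min_eq_left this, max_eq_right zero_le_one, AffineMap.lineMap_apply_one]

theorem transition_of_mem {c d : ℝ} (h : c < d) (u w : V) {x : ℝ} (hcx : c ≤ x) (hxd : x ≤ d) :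
    transition c d u w x = lineMap u w ((x - c) / (d - c)) := by
  rw [transition, min_eq_right ((div_le_one (by linarith)).2 (by linarith)),
    max_eq_right (div_nonneg (by linarith) (by linarith))]

end Transition

/-- The map of three-space that is affine in `x` and, on each plane `x = const`, a complex affine
map of `y + i z`. -/
noncomputable def fiberMap (a b : ℝ) (α β : ℝ → ℂ) (p : R3) : R3 :=
  (a * p.1 + b, equivRealProdCLM (α p.1 * equivRealProdCLM.symm p.2 + β p.1))

section FiberMap

variable {a b : ℝ} {α β : ℝ → ℂ}

theorem continuous_fiberMap (hα : Continuous α) (hβ : Continuous β) :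
    Continuous (fiberMap a b α β) := by
  unfold fiberMap
  fun_prop

theorem isHomeomorph_fiberMap (ha : a ≠ 0) (hα : Continuous α) (hβ : Continuous β)
    (hα₀ : ∀ x, α x ≠ 0) : IsHomeomorph (fiberMap a b α β) := by
  let g : ℝ → ℝ := fun x => (x - b) / a
  have hg : Continuous g := by fun_prop
  have hg₁ : ∀ x, g (a * x + b) = x := fun x => by simp [g, ha]
  have hg₂ : ∀ x, a * g x + b = x := fun x => by simp [g, mul_div_cancel₀ _ ha]
  refine isHomeomorph_iff_exists_inverse.2 ⟨continuous_fiberMap hα hβ,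
    fun p => (g p.1, equivRealProdCLM ((equivRealProdCLM.symm p.2 - β (g p.1)) / α (g p.1))),
    fun p => ?_, fun p => ?_, ?_⟩
  · simp only [fiberMap, hg₁, ContinuousLinearEquiv.symm_apply_apply, add_sub_cancel_right,
      mul_div_cancel_left₀ _ (hα₀ p.1), ContinuousLinearEquiv.apply_symm_apply]
  · simp only [fiberMap, hg₂, ContinuousLinearEquiv.symm_apply_apply,
      mul_div_cancel₀ _ (hα₀ (g p.1)), sub_add_cancel, ContinuousLinearEquiv.apply_symm_apply]
  · have : ∀ p : R3, α (g p.1) ≠ 0 := fun p => hα₀ _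
    fun_prop (disch := assumption)

theorem exists_isAmbientIsotopy_fiberMap (ha : 0 < a) (b : ℝ) {α β : unitInterval → ℝ → ℂ}
    (hα : Continuous ↿α) (hβ : Continuous ↿β) (hα₀ : ∀ t x, α t x ≠ 0)
    (hα₁ : ∀ x, α 0 x = 1) (hβ₁ : ∀ x, β 0 x = 0) :
    ∃ H : unitInterval × R3 → R3, IsAmbientIsotopy H ∧
      ∀ p, H (1, p) = fiberMap a b (α 1) (β 1) p := by
  have hslope : ∀ t : unitInterval, (lineMap 1 a (t : ℝ) : ℝ) ≠ 0 := fun t =>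
    ne_of_gt ((convex_Ioi (0 : ℝ)).lineMap_mem (Set.mem_Ioi.2 one_pos) ha t.2)
  refine ⟨fun P => fiberMap (lineMap 1 a (P.1 : ℝ)) (P.1 * b) (α P.1) (β P.1) P.2,
    ⟨?_, fun t => ?_, fun p => by simp [fiberMap, hα₁, hβ₁]⟩, fun p => by simp⟩
  · have hfst : Continuous fun P : unitInterval × R3 => (P.1, P.2.1) := by fun_prop
    have : Continuous fun P : unitInterval × R3 => α P.1 P.2.1 := hα.comp hfst
    have : Continuous fun P : unitInterval × R3 => β P.1 P.2.1 := hβ.comp hfst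
    have : Continuous fun P : unitInterval × R3 => (lineMap 1 a (P.1 : ℝ) : ℝ) :=
      AffineMap.lineMap_continuous.comp (by fun_prop)
    unfold fiberMap
    fun_prop
  · exact isHomeomorph_fiberMap (b := t * b) (hslope t) (hα.uncurry_left t) (hβ.uncurry_left t)
      (hα₀ t)

theorem image_edgeSegment_of_lineMap {φ : R3 → R3} {e : R3 × R3}
    (h : ∀ s : ℝ, lineMap e.1 e.2 s ∈ edgeSegment e →
      φ (lineMap e.1 e.2 s) = lineMap (φ e.1) (φ e.2) s) :
    φ '' edgeSegment e = edgeSegment (φ e.1, φ e.2) := by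
  simp only [edgeSegment, segment_eq_image_lineMap, Set.image_image] at h ⊢
  exact Set.image_congr fun s hs => h s ⟨s, hs, rfl⟩

theorem image_fiberMap_of_const {e : R3 × R3} {u w : ℂ} (hα : ∀ x ∈ edgeSegment e, α x.1 = u)
    (hβ : ∀ x ∈ edgeSegment e, β x.1 = w) : fiberMap a b α β '' edgeSegment e =
      edgeSegment (fiberMap a b α β e.1, fiberMap a b α β e.2) := by
  refine image_edgeSegment_of_lineMap fun s hs => ?_
  simp only [fiberMap, hα _ hs, hβ _ hs, hα _ (left_mem_segment ℝ e.1 e.2),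
    hα _ (right_mem_segment ℝ e.1 e.2), hβ _ (left_mem_segment ℝ e.1 e.2),
    hβ _ (right_mem_segment ℝ e.1 e.2)]
  ext <;> simp [lineMap_apply] <;> ring

theorem image_fiberMap_of_snd_eq {e : R3 × R3} (he : e.1.2 = e.2.2) {u w : ℂ}
    (hα : ∀ x ∈ edgeSegment e, α x.1 = u * x.1 + w) : fiberMap a b α 0 '' edgeSegment e =
      edgeSegment (fiberMap a b α 0 e.1, fiberMap a b α 0 e.2) := by
  refine image_edgeSegment_of_lineMap fun s hs => ?_
  simp only [fiberMap, hα _ hs, hα _ (left_mem_segment ℝ e.1 e.2),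
    hα _ (right_mem_segment ℝ e.1 e.2)]
  ext <;> simp [lineMap_apply, he] <;> ring

end FiberMap

theorem exists_exp_mul_add {u w u' w' : ℂ} (h : u ≠ w) (h' : u' ≠ w') :
    ∃ k b : ℂ, Complex.exp k * u + b = u' ∧ Complex.exp k * w + b = w' := by
  have hu : u - w ≠ 0 := sub_ne_zero.2 h
  refine ⟨Complex.log ((u' - w') / (u - w)), u' - (u' - w') / (u - w) * u, ?_, ?_⟩ <;>
    rw [Complex.exp_log (div_ne_zero (sub_ne_zero.2 h') hu)]
  · ring
  · field_simp
    ring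

/-- The coordinate along which the two parts of a split link are separated. -/
abbrev fstCoord : R3 →ₗ[ℝ] ℝ := LinearMap.fst ℝ ℝ (ℝ × ℝ)

theorem exists_isAmbientIsotopy_align {c d c' d' : ℝ} (hcd : c < d) (hcd' : c' < d')
    {u v u' v' z w : ℝ × ℝ} (huv : u ≠ v) (huv' : u' ≠ v') (hzw : z ≠ w) :
    ∃ H : unitInterval × R3 → R3, IsAmbientIsotopy H ∧
      H (1, (c, u)) = (c', z) ∧ H (1, (c, v)) = (c', w) ∧
      H (1, (d, u')) = (d', z) ∧ H (1, (d, v')) = (d', w) ∧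
      (∃ a b : ℝ, 0 < a ∧ ∀ x, (H (1, x)).1 = a * x.1 + b) ∧
      ∀ e : R3 × R3, (∀ x ∈ edgeSegment e, x.1 ≤ c) ∨ (∀ x ∈ edgeSegment e, d ≤ x.1) →
        (fun x => H (1, x)) '' edgeSegment e = edgeSegment (H (1, e.1), H (1, e.2)) := by
  have hinj : Function.Injective equivRealProdCLM.symm := equivRealProdCLM.symm.injective
  obtain ⟨k, b, hu, hv⟩ := exists_exp_mul_add (hinj.ne huv) (hinj.ne hzw)
  obtain ⟨k', b', hu', hv'⟩ := exists_exp_mul_add (hinj.ne huv') (hinj.ne hzw)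
  let a := (d' - c') / (d - c)
  have ha : 0 < a := div_pos (sub_pos.2 hcd') (sub_pos.2 hcd)
  have hd : a * d + (c' - a * c) = d' := by
    have : a * (d - c) = d' - c' := div_mul_cancel₀ _ (sub_pos.2 hcd).ne'
    linarith
  let α : unitInterval → ℝ → ℂ := fun t x => Complex.exp ((t : ℝ) * transition c d k k' x)
  let β : unitInterval → ℝ → ℂ := fun t x => (t : ℝ) * transition c d b b' x
  have hk := continuous_transition c d k k'
  have hb := continuous_transition c d b b'
  have hαl : ∀ x ≤ c, α 1 x = Complex.exp k := fun x hx => by simp [α, transition_of_le hcd _ _ hx]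
  have hαr : ∀ x, d ≤ x → α 1 x = Complex.exp k' := fun x hx => by
    simp [α, transition_of_ge hcd _ _ hx]
  have hβl : ∀ x ≤ c, β 1 x = b := fun x hx => by simp [β, transition_of_le hcd _ _ hx]
  have hβr : ∀ x, d ≤ x → β 1 x = b' := fun x hx => by simp [β, transition_of_ge hcd _ _ hx]
  have hα : Continuous ↿α := by
    simp only [Function.HasUncurry.uncurry, α, id]
    fun_prop
  have hβ : Continuous ↿β := by
    simp only [Function.HasUncurry.uncurry, β, id]
    fun_prop
  obtain ⟨H, hH, hH₁⟩ := exists_isAmbientIsotopy_fiberMap ha (c' - a * c) hα hβ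
    (fun t x => Complex.exp_ne_zero _) (fun x => by simp [α]) (fun x => by simp [β])
  refine ⟨H, hH, ?_, ?_, ?_, ?_, ⟨a, c' - a * c, ha, fun x => by rw [hH₁, fiberMap]⟩, ?_⟩
  · simp [hH₁, fiberMap, hαl, hβl, hu]
  · simp [hH₁, fiberMap, hαl, hβl, hv]
  · simp [hH₁, fiberMap, hαr, hβr, hu', hd]
  · simp [hH₁, fiberMap, hαr, hβr, hv', hd]
  · simp only [hH₁]
    rintro e (he | he)
    · exact image_fiberMap_of_const (fun x hx => hαl _ (he x hx)) fun x hx => hβl _ (he x hx)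
    · exact image_fiberMap_of_const (fun x hx => hαr _ (he x hx)) fun x hx => hβr _ (he x hx)

theorem LiesBelow.of_image {ℓ : R3 →ₗ[ℝ] ℝ} {c : ℝ} {S : Set R3} {e f : R3 × R3}
    (h : LiesBelow ℓ c S e) {φ : R3 → R3} {a b : ℝ} (ha : 0 < a) (hφ : ∀ x, ℓ (φ x) = a * ℓ x + b)
    (hf : φ '' edgeSegment e = edgeSegment f) : LiesBelow ℓ (a * c + b) (φ '' S) f := by
  intro y hy
  obtain ⟨x, hx, rfl⟩ := hf.symm.subset hy
  rw [hφ, add_left_inj, mul_right_inj' ha.ne']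
  refine ⟨?_, fun hxc => ⟨x, (h x hx).2 hxc, rfl⟩⟩
  gcongr
  exact (h x hx).1

/-- The endpoints of the strand by which the left part of a split link in normal form is connected
to the region `-10 ≤ x ≤ 10`. -/
def leftEnds : Set R3 := {(-10, 0, 10), (-10, 0, -10)}

/-- The endpoints of the strand by which the right part of a split link in normal form is connected
to the region `-10 ≤ x ≤ 10`. -/
def rightEnds : Set R3 := {(10, 0, 10), (10, 0, -10)}

/-- A set of edges which meets the region `-10 ≤ x ≤ 10` only in `leftEnds` and `rightEnds`. -/
def IsBody (E : Set (R3 × R3)) : Prop :=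
  ∀ e ∈ E, LiesBelow fstCoord (-10) leftEnds e ∨ LiesBelow (-fstCoord) (-10) rightEnds e

/-- A link in normal form with body `E`: inside the region `-10 ≤ x ≤ 10` it consists of two
vertical strands. -/
def OrientedLink.IsNormalForm (N : OrientedLink) (E : Set (R3 × R3)) : Prop :=
  IsBody E ∧ N.edges = E ∪ {((-10, 0, 10), (-10, 0, -10)), ((10, 0, 10), (10, 0, -10))}

theorem OrientedLink.exists_isNormalForm {L : OrientedLink} {A B : Set (R3 × R3)}
    (hL : L.edges = A ∪ B) (hA₀ : A.Nonempty) (hB₀ : B.Nonempty)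
    (hA : ∀ e ∈ A, e.1.1 < 0 ∧ e.2.1 < 0) (hB : ∀ e ∈ B, 0 < e.1.1 ∧ 0 < e.2.1) :
    ∃ (N : OrientedLink) (E : Set (R3 × R3)), N.IsNormalForm E ∧ N.linkType = L.linkType := by
  obtain ⟨M, E, ⟨c, u⟩, ⟨c₁, v⟩, ⟨d, u'⟩, ⟨d₁, v'⟩, _, _, hML, hcd, rfl, hc, rfl, hd, hM, hE⟩ :=
    exists_extreme_edges (ℓ := fstCoord) hL hA₀ hB₀ hA hB
  obtain rfl : c = c₁ := hc.symm
  obtain rfl : d = d₁ := hd.symm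
  simp only [LinearMap.fst_apply] at *
  have huv : u ≠ v := by simpa using M.nondegenerate ((c, u), (c, v)) (by simp [hM])
  have huv' : u' ≠ v' := by simpa using M.nondegenerate ((d, u'), (d, v')) (by simp [hM])
  obtain ⟨H, hH, hu, hv, hu', hv', ⟨a, b, ha, hab⟩, hside⟩ :=
    exists_isAmbientIsotopy_align hcd (c' := -10) (d' := 10) (by norm_num) huv huv'
      (z := (0, 10)) (w := (0, -10)) (by norm_num [Prod.ext_iff])
  have hc : a * c + b = -10 := by simpa [hu] using (hab (c, u)).symm
  have hd : a * d + b = 10 := by simpa [hu'] using (hab (d, u')).symm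
  have hEside : ∀ e ∈ E, (∀ x ∈ edgeSegment e, x.1 ≤ c) ∨ (∀ x ∈ edgeSegment e, d ≤ x.1) :=
    fun e he => (hE e he).imp (fun h x hx => (h x hx).1) fun h x hx => neg_le_neg_iff.1 (h x hx).1
  have hseg : ∀ e ∈ M.edges,
      (fun x => H (1, x)) '' edgeSegment e = edgeSegment (H (1, e.1), H (1, e.2)) := fun e he => by
    rw [hM] at he
    refine hside e ?_
    obtain rfl | rfl | he := he
    · exact Or.inl <|
        (convex_halfSpace_le fstCoord.isLinear c).segment_subset (le_refl c) (le_refl c)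
    · exact Or.inr <|
        (convex_halfSpace_ge fstCoord.isLinear d).segment_subset (le_refl d) (le_refl d)
    · exact hEside e he
  refine ⟨M.map (fun x => H (1, x)) (hH.2.1 1).injective hseg,
    (fun e : R3 × R3 => (H (1, e.1), H (1, e.2))) '' E, ⟨?_, ?_⟩,
    (M.isotopic_map hH hseg).linkType_eq.symm.trans hML⟩
  · rintro _ ⟨e, he, rfl⟩
    have heM := hseg e (hM ▸ Or.inr (Or.inr he))
    refine (hE e he).imp (fun h => ?_) fun h => ?_
    · have := h.of_image ha hab heM
      rwa [hc, Set.image_pair, hu, hv] at this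
    · have := h.of_image (b := -b) ha (fun x => by simp [hab]; ring) heM
      rwa [Set.image_pair, hu', hv', show a * -d + -b = -10 by linarith] at this
  · change (fun e : R3 × R3 => (H (1, e.1), H (1, e.2))) '' M.edges = _
    rw [hM, Set.image_insert_eq, Set.image_insert_eq, hu, hv, hu', hv', Set.union_comm,
      Set.insert_union, Set.singleton_union]

theorem LiesBelow.inter_subset {ℓ : R3 →ₗ[ℝ] ℝ} {c : ℝ} {S T : Set R3} {e : R3 × R3}
    (h : LiesBelow ℓ c S e) (hT : ∀ x ∈ T, c ≤ ℓ x) : T ∩ edgeSegment e ⊆ S :=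
  fun x hx => (h x hx.2).2 ((h x hx.2).1.antisymm (hT x hx.1))

theorem liesBelow_of_endpoints {ℓ : R3 →ₗ[ℝ] ℝ} {c : ℝ} {S : Set R3} {a b : R3} (ha : ℓ a ≤ c)
    (hb : ℓ b ≤ c) (haS : ℓ a = c → a ∈ S) (hbS : ℓ b = c → b ∈ S)
    (hab : ℓ a = c → ℓ b = c → a = b) : LiesBelow ℓ c S (a, b) := by
  obtain ha' | ha' := ha.eq_or_lt <;> obtain hb' | hb' := hb.eq_or_lt
  · obtain rfl := hab ha' hb'
    intro x hx
    obtain rfl : x = a := by simpa [edgeSegment] using hx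
    exact ⟨ha, haS⟩
  · subst ha'
    exact (liesBelow_singleton hb').swap.mono (Set.singleton_subset_iff.2 (haS rfl))
  · subst hb'
    exact (liesBelow_singleton ha').mono (Set.singleton_subset_iff.2 (hbS rfl))
  · exact liesBelow_of_lt ha' hb' S

section TriangleSeparation

variable {ℓ : R3 →ₗ[ℝ] ℝ} {c : ℝ} {p q r : R3} {e : R3 × R3}

theorem convexHull_inter_edgeSegment_subset_of_edge_below (he : LiesBelow ℓ c {p, q} e)
    (hp : c ≤ ℓ p) (hq : c ≤ ℓ q) (hr : c ≤ ℓ r) :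
    convexHull ℝ {p, q, r} ∩ edgeSegment e ⊆ {p, q} := by
  refine he.inter_subset fun x hx => convexHull_min ?_ (convex_halfSpace_ge ℓ.isLinear c) hx
  rintro y (rfl | rfl | rfl)
  exacts [hp, hq, hr]

theorem convexHull_inter_edgeSegment_subset_of_triangle_below (hpq : LiesBelow ℓ c {p, q} (p, q))
    (hr : ℓ r < c) (h₁ : c ≤ ℓ e.1) (h₂ : c ≤ ℓ e.2) :
    convexHull ℝ {p, q, r} ∩ edgeSegment e ⊆ {p, q} := by
  rintro x ⟨hx, hxe⟩
  have hcx : c ≤ ℓ x := (convex_halfSpace_ge ℓ.isLinear c).segment_subset h₁ h₂ hxe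
  have hxr : x ∈ convexHull ℝ (insert r {p, q}) := by
    rwa [Set.insert_comm r, Set.pair_comm r]
  rw [convexHull_insert (Set.insert_nonempty p {q}), convexHull_pair, mem_convexJoin] at hxr
  obtain ⟨_, rfl, y, hy, hxy⟩ := hxr
  have hyc : ℓ y ≤ c := (hpq y hy).1
  obtain hyc | hyc := hyc.lt_or_eq
  · exact absurd hcx (not_le.2
      ((convex_halfSpace_lt ℓ.isLinear c).segment_subset hr hyc hxy))
  · obtain rfl : x = y := eq_right_of_mem_segment hxy (hr.trans_eq hyc.symm) (hyc.trans_le hcx)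
    exact (hpq x hy).2 hyc

end TriangleSeparation

/-- A point with half-integral coordinates: `v` stands for `v / 2`. All links occurring in the
moves below have such vertices, so that the moves can be checked by integer arithmetic. -/
abbrev IntPoint : Type := ℤ × ℤ × ℤ

namespace IntPoint

/-- The point of three-space that an integer point stands for. -/
noncomputable def toR3 (v : IntPoint) : R3 := ((v.1 : ℝ) / 2, (v.2.1 : ℝ) / 2, (v.2.2 : ℝ) / 2)

theorem toR3_injective : Function.Injective toR3 := fun v w h => by
  simp only [toR3, Prod.mk.injEq, div_left_inj' (two_ne_zero' ℝ), Int.cast_inj] at h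
  exact Prod.ext h.1 (Prod.ext h.2.1 h.2.2)

/-- The standard scalar product. -/
def dot (v w : IntPoint) : ℤ := v.1 * w.1 + v.2.1 * w.2.1 + v.2.2 * w.2.2

/-- The cross product. -/
def cross (v w : IntPoint) : IntPoint :=
  (v.2.1 * w.2.2 - v.2.2 * w.2.1, v.2.2 * w.1 - v.1 * w.2.2, v.1 * w.2.1 - v.2.1 * w.1)

/-- The linear functional `⟨n, ·⟩` on three-space. -/
noncomputable def functional (n : IntPoint) : R3 →ₗ[ℝ] ℝ :=
  (n.1 : ℝ) • LinearMap.fst ℝ ℝ (ℝ × ℝ) +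
    (n.2.1 : ℝ) • (LinearMap.fst ℝ ℝ ℝ ∘ₗ LinearMap.snd ℝ ℝ (ℝ × ℝ)) +
    (n.2.2 : ℝ) • (LinearMap.snd ℝ ℝ ℝ ∘ₗ LinearMap.snd ℝ ℝ (ℝ × ℝ))

theorem functional_apply (n : IntPoint) (x : R3) :
    n.functional x = n.1 * x.1 + n.2.1 * x.2.1 + n.2.2 * x.2.2 := rfl

theorem functional_toR3 (n v : IntPoint) : n.functional v.toR3 = (n.dot v : ℝ) / 2 := by
  simp only [functional_apply, toR3, dot]
  push_cast
  ring

theorem functional_toR3_le {n v : IntPoint} {c : ℤ} :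
    n.functional v.toR3 ≤ (c : ℝ) / 2 ↔ n.dot v ≤ c := by
  rw [functional_toR3, div_le_div_iff_of_pos_right two_pos, Int.cast_le]

theorem le_functional_toR3 {n v : IntPoint} {c : ℤ} :
    (c : ℝ) / 2 ≤ n.functional v.toR3 ↔ c ≤ n.dot v := by
  rw [functional_toR3, div_le_div_iff_of_pos_right two_pos, Int.cast_le]

theorem functional_toR3_lt {n v : IntPoint} {c : ℤ} :
    n.functional v.toR3 < (c : ℝ) / 2 ↔ n.dot v < c := by
  rw [functional_toR3, div_lt_div_iff_of_pos_right two_pos, Int.cast_lt]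

theorem functional_toR3_eq {n v : IntPoint} {c : ℤ} :
    n.functional v.toR3 = (c : ℝ) / 2 ↔ n.dot v = c := by
  rw [functional_toR3, div_left_inj' two_ne_zero, Int.cast_inj]

/-- The path `p r q` does not turn back on itself. -/
def Turns (p r q : IntPoint) : Prop :=
  (r - p).cross (q - r) ≠ 0 ∨ 0 < (r - p).dot (q - r)

instance (p r q : IntPoint) : Decidable (Turns p r q) := inferInstanceAs (Decidable (_ ∨ _))

theorem Turns.symm {p r q : IntPoint} (h : Turns p r q) : Turns q r p := by
  refine h.imp (mt fun h => ?_) fun h => ?_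
  · simp only [cross, Prod.ext_iff, Prod.fst_sub, Prod.snd_sub, Prod.fst_zero, Prod.snd_zero] at h ⊢
    refine ⟨?_, ?_, ?_⟩ <;> linarith
  · simp only [dot, Prod.fst_sub, Prod.snd_sub] at h ⊢
    linarith

theorem Turns.left_notMem_segment {p r q : IntPoint} (h : Turns p r q) :
    p.toR3 ∉ segment ℝ r.toR3 q.toR3 := by
  rw [segment_eq_image']
  rintro ⟨t, ⟨ht, -⟩, hp⟩
  obtain ⟨h₁, h₂, h₃⟩ : (r.1 : ℝ) - p.1 = -t * (q.1 - r.1) ∧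
      (r.2.1 : ℝ) - p.2.1 = -t * (q.2.1 - r.2.1) ∧ (r.2.2 : ℝ) - p.2.2 = -t * (q.2.2 - r.2.2) := by
    simp only [toR3, Prod.ext_iff, Prod.fst_add, Prod.snd_add, Prod.smul_fst, Prod.smul_snd,
      Prod.fst_sub, Prod.snd_sub, smul_eq_mul] at hp
    refine ⟨?_, ?_, ?_⟩ <;> linarith
  obtain h | h := h
  · refine h (Prod.ext ?_ (Prod.ext ?_ ?_)) <;> rw [← Int.cast_inj (α := ℝ)] <;>
      simp only [cross, Prod.fst_sub, Prod.snd_sub, Prod.fst_zero, Prod.snd_zero] <;>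
      push_cast <;> simp only [h₁, h₂, h₃] <;> ring
  · rw [← Int.cast_pos (R := ℝ)] at h
    simp only [dot, Prod.fst_sub, Prod.snd_sub] at h
    push_cast at h
    rw [h₁, h₂, h₃] at h
    nlinarith [mul_nonneg ht (sq_nonneg ((q.1 : ℝ) - r.1)),
      mul_nonneg ht (sq_nonneg ((q.2.1 : ℝ) - r.2.1)),
      mul_nonneg ht (sq_nonneg ((q.2.2 : ℝ) - r.2.2))]

theorem Turns.right_notMem_segment {p r q : IntPoint} (h : Turns p r q) :
    q.toR3 ∉ segment ℝ p.toR3 r.toR3 := by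
  rw [segment_symm]
  exact h.symm.left_notMem_segment

end IntPoint

/-- A directed edge between integer points. -/
abbrev IntEdge : Type := IntPoint × IntPoint

/-- The directed edge in three-space that an integer edge stands for. -/
noncomputable def IntEdge.toR3 (e : IntEdge) : R3 × R3 := (e.1.toR3, e.2.toR3)

theorem IntEdge.toR3_injective : Function.Injective IntEdge.toR3 :=
  IntPoint.toR3_injective.prodMap IntPoint.toR3_injective

/-- The integer version of `_root_.LiesBelow`, tested at the endpoints. -/
def IntEdge.LiesBelow (n : IntPoint) (c : ℤ) (l : List IntPoint) (e : IntEdge) : Prop :=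
  n.dot e.1 ≤ c ∧ n.dot e.2 ≤ c ∧ (n.dot e.1 = c → e.1 ∈ l) ∧ (n.dot e.2 = c → e.2 ∈ l) ∧
    (n.dot e.1 = c → n.dot e.2 = c → e.1 = e.2)

instance (n : IntPoint) (c : ℤ) (l : List IntPoint) (e : IntEdge) :
    Decidable (e.LiesBelow n c l) :=
  inferInstanceAs (Decidable (_ ∧ _))

theorem IntEdge.LiesBelow.toR3 {n : IntPoint} {c : ℤ} {l : List IntPoint} {e : IntEdge}
    (h : e.LiesBelow n c l) : _root_.LiesBelow n.functional (c / 2) (IntPoint.toR3 '' {v | v ∈ l})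
      e.toR3 := by
  obtain ⟨h₁, h₂, h₁l, h₂l, h₁₂⟩ := h
  refine liesBelow_of_endpoints (IntPoint.functional_toR3_le.2 h₁)
    (IntPoint.functional_toR3_le.2 h₂) ?_ ?_ ?_ <;> simp only [IntPoint.functional_toR3_eq]
  · exact fun h => ⟨_, h₁l h, rfl⟩
  · exact fun h => ⟨_, h₂l h, rfl⟩
  · exact fun h h' => congrArg IntPoint.toR3 (h₁₂ h h')

namespace IntPoint

/-- The functional `n` shows that the triangle `p q r` meets the edge `e` at most in `p` and `q`:
a level of `n` separates the two, and it is attained only at `p` and `q`. -/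
def Separates (n p q r : IntPoint) (e : IntEdge) : Prop :=
  (max (n.dot e.1) (n.dot e.2) ≤ n.dot p ∧ max (n.dot e.1) (n.dot e.2) ≤ n.dot q ∧
    max (n.dot e.1) (n.dot e.2) ≤ n.dot r ∧
    e.LiesBelow n (max (n.dot e.1) (n.dot e.2)) [p, q]) ∨
  (n.dot r < min (n.dot e.1) (n.dot e.2) ∧
    IntEdge.LiesBelow n (min (n.dot e.1) (n.dot e.2)) [p, q] (p, q))

instance (n p q r : IntPoint) (e : IntEdge) : Decidable (Separates n p q r e) :=
  inferInstanceAs (Decidable (_ ∨ _))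

theorem Separates.inter_subset {n p q r : IntPoint} {e : IntEdge} (h : Separates n p q r e) :
    convexHull ℝ {p.toR3, q.toR3, r.toR3} ∩ edgeSegment e.toR3 ⊆ {p.toR3, q.toR3} := by
  have himage : toR3 '' {v | v ∈ [p, q]} ⊆ {p.toR3, q.toR3} := by
    rintro _ ⟨v, hv, rfl⟩
    simpa [toR3_injective.eq_iff] using hv
  obtain ⟨hp, hq, hr, he⟩ | ⟨hr, hpq⟩ := h
  · exact convexHull_inter_edgeSegment_subset_of_edge_below (he.toR3.mono himage)
      (le_functional_toR3.2 hp) (le_functional_toR3.2 hq) (le_functional_toR3.2 hr)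
  · exact convexHull_inter_edgeSegment_subset_of_triangle_below (hpq.toR3.mono himage)
      (functional_toR3_lt.2 hr) (le_functional_toR3.2 (min_le_left _ _))
      (le_functional_toR3.2 (min_le_right _ _))

/-- Candidates for a functional that separates the triangle `p q r` from the edge `e`. -/
def normals (p q r : IntPoint) (e : IntEdge) : List IntPoint :=
  let t := q - p
  let u := r - p
  let v := r - q
  let s := e.2 - e.1
  let n := t.cross u
  [(1, 0, 0), (0, 1, 0), (0, 0, 1), n, t.cross s, u.cross s, v.cross s, t.cross n, u.cross n,
    v.cross n, s.cross n, u, u.cross (u.cross s), s.cross (u.cross s), u.cross (u.cross (e.1 - p))]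

/-- A test for the triangle `p q r` to meet the edge `e` at most in `p` and `q`. -/
def TriangleAvoids (p q r : IntPoint) (e : IntEdge) : Prop :=
  ∃ n ∈ normals p q r e, Separates n p q r e ∨ Separates (-n) p q r e

instance (p q r : IntPoint) (e : IntEdge) : Decidable (TriangleAvoids p q r e) :=
  inferInstanceAs (Decidable (∃ n ∈ normals p q r e, _))

theorem TriangleAvoids.inter_subset {p q r : IntPoint} {e : IntEdge}
    (h : TriangleAvoids p q r e) :
    convexHull ℝ {p.toR3, q.toR3, r.toR3} ∩ edgeSegment e.toR3 ⊆ {p.toR3, q.toR3} := by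
  obtain ⟨n, -, h | h⟩ := h
  exacts [h.inter_subset, h.inter_subset]

end IntPoint

/-- The edges in three-space that a list of integer edges stands for. -/
def edgeSet (st : List IntEdge) : Set (R3 × R3) := IntEdge.toR3 '' {e | e ∈ st}

theorem edgeSet_nil : edgeSet [] = ∅ := by
  simp [edgeSet]

theorem edgeSet_cons (e : IntEdge) (st : List IntEdge) :
    edgeSet (e :: st) = insert e.toR3 (edgeSet st) := by
  simp only [edgeSet, List.mem_cons, ← Set.image_insert_eq]
  rfl

theorem edgeSet_append (st st' : List IntEdge) :
    edgeSet (st ++ st') = edgeSet st ∪ edgeSet st' := by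
  simp only [edgeSet, List.mem_append, ← Set.image_union]
  rfl

theorem edgeSet_eq_insert {e : IntEdge} {st : List IntEdge} (he : e ∈ st) :
    edgeSet st = insert e.toR3 (edgeSet (st.filter (· ≠ e))) := by
  rw [edgeSet, edgeSet, ← Set.image_insert_eq]
  congr 1
  ext f
  by_cases hf : f = e <;> simp [hf, he]

theorem toR3_mem_edgeSet_iff {e : IntEdge} {st : List IntEdge} : e.toR3 ∈ edgeSet st ↔ e ∈ st :=
  IntEdge.toR3_injective.mem_set_image

theorem edgeSet_eq_of_perm {st st' : List IntEdge} (h : st.Perm st') :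
    edgeSet st = edgeSet st' := by
  simp only [edgeSet, h.mem_iff]

/-- The points of `leftEnds` and `rightEnds`. -/
def corners : List IntPoint := [(-20, 0, 20), (-20, 0, -20), (20, 0, 20), (20, 0, -20)]

theorem leftEnds_union_rightEnds_subset :
    leftEnds ∪ rightEnds ⊆ IntPoint.toR3 '' {v | v ∈ corners} := by
  rintro _ ((rfl | rfl) | (rfl | rfl))
  · exact ⟨(-20, 0, 20), by simp [corners], by norm_num [IntPoint.toR3]⟩
  · exact ⟨(-20, 0, -20), by simp [corners], by norm_num [IntPoint.toR3]⟩
  · exact ⟨(20, 0, 20), by simp [corners], by norm_num [IntPoint.toR3]⟩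
  · exact ⟨(20, 0, -20), by simp [corners], by norm_num [IntPoint.toR3]⟩

/-- The point lies in the region `-10 ≤ x ≤ 10`. -/
def IntPoint.InSlab (v : IntPoint) : Prop := -20 ≤ v.1 ∧ v.1 ≤ 20

instance (v : IntPoint) : Decidable v.InSlab := inferInstanceAs (Decidable (_ ∧ _))

/-- The region in which the moves take place. -/
def slab : Set R3 := {x | -10 ≤ x.1 ∧ x.1 ≤ 10}

theorem convex_slab : Convex ℝ slab :=
  (convex_halfSpace_ge fstCoord.isLinear (-10)).inter (convex_halfSpace_le fstCoord.isLinear 10)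

theorem IntPoint.InSlab.toR3_mem_slab {v : IntPoint} (h : v.InSlab) : v.toR3 ∈ slab := by
  obtain ⟨h₁, h₂⟩ := h
  rify at h₁ h₂
  constructor <;> simp only [IntPoint.toR3] <;> linarith

theorem IsBody.slab_inter_subset {E : Set (R3 × R3)} (hE : IsBody E) {e : R3 × R3} (he : e ∈ E) :
    slab ∩ edgeSegment e ⊆ IntPoint.toR3 '' {v | v ∈ corners} := by
  refine Set.Subset.trans ?_ leftEnds_union_rightEnds_subset
  obtain h | h := hE e he
  · exact Set.subset_union_of_subset_left (h.inter_subset fun x hx => hx.1) _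
  · exact Set.subset_union_of_subset_right (h.inter_subset fun x hx => neg_le_neg hx.2) _

theorem infinite_segment {E : Type*} [AddCommGroup E] [Module ℝ E] {p q : E} (hpq : p ≠ q) :
    (segment ℝ p q).Infinite := by
  rw [segment_eq_image_lineMap]
  exact (Set.Icc_infinite zero_lt_one).image (AffineMap.lineMap_injective ℝ hpq).injOn

theorem IsBody.notMem {E : Set (R3 × R3)} (hE : IsBody E) {e : R3 × R3} (hne : e.1 ≠ e.2)
    (h₁ : e.1 ∈ slab) (h₂ : e.2 ∈ slab) : e ∉ E := fun he =>
  infinite_segment hne (((List.finite_toSet corners).image IntPoint.toR3).subset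
    fun _ hx => hE.slab_inter_subset he ⟨convex_slab.segment_subset h₁ h₂ hx, hx⟩)

/-- The triangle `p q r` lies in the slab and meets the edges in `st`, and those of any body, at
most in `p` and `q`. -/
def AvoidsAll (p q r : IntPoint) (st : List IntEdge) : Prop :=
  p.InSlab ∧ q.InSlab ∧ r.InSlab ∧
    ∀ e ∈ st ++ corners.map (fun c => (c, c)), IntPoint.TriangleAvoids p q r e

instance (p q r : IntPoint) (st : List IntEdge) : Decidable (AvoidsAll p q r st) :=
  inferInstanceAs (Decidable (_ ∧ _))

theorem AvoidsAll.inter_subset {p q r : IntPoint} {st : List IntEdge} (h : AvoidsAll p q r st)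
    {E : Set (R3 × R3)} (hE : IsBody E) {g : R3 × R3} (hg : g ∈ E ∪ edgeSet st) :
    convexHull ℝ {p.toR3, q.toR3, r.toR3} ∩ edgeSegment g ⊆ {p.toR3, q.toR3} := by
  obtain ⟨hp, hq, hr, h⟩ := h
  obtain hg | ⟨e, he, rfl⟩ := hg
  · rintro x ⟨hx, hxg⟩
    have hslab : convexHull ℝ {p.toR3, q.toR3, r.toR3} ⊆ slab := convexHull_min (by
      rintro y (rfl | rfl | rfl)
      exacts [hp.toR3_mem_slab, hq.toR3_mem_slab, hr.toR3_mem_slab]) convex_slab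
    obtain ⟨c, hc, rfl⟩ := hE.slab_inter_subset hg ⟨hslab hx, hxg⟩
    exact (h (c, c) (List.mem_append_right _ (List.mem_map_of_mem hc))).inter_subset
      ⟨hx, left_mem_segment ℝ _ _⟩
  · exact (h e (List.mem_append_left _ he)).inter_subset

/-- The edge `p q` can be replaced by the path `p r q`, or conversely, by moving across the
triangle, if `st` is the list of the other edges. -/
def IsFreeTriangle (p q r : IntPoint) (st : List IntEdge) : Prop :=
  AvoidsAll p q r st ∧ IntPoint.Turns p r q

instance (p q r : IntPoint) (st : List IntEdge) : Decidable (IsFreeTriangle p q r st) :=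
  inferInstanceAs (Decidable (_ ∧ _))

/-- The path `p r q` meets the edges in `st` and those of any body at most in its ends. -/
def IsFreePath (p q r : IntPoint) (st : List IntEdge) : Prop :=
  AvoidsAll p p r st ∧ AvoidsAll q q r st ∧ IntPoint.Turns p r q

instance (p q r : IntPoint) (st : List IntEdge) : Decidable (IsFreePath p q r st) :=
  inferInstanceAs (Decidable (_ ∧ _))

theorem IsFreePath.inter_subset {p q r : IntPoint} {st : List IntEdge} (h : IsFreePath p q r st)
    {E : Set (R3 × R3)} (hE : IsBody E) {g : R3 × R3} (hg : g ∈ E ∪ edgeSet st) :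
    (segment ℝ p.toR3 r.toR3 ∪ segment ℝ r.toR3 q.toR3) ∩ edgeSegment g ⊆ {p.toR3, q.toR3} := by
  have hp := h.1.inter_subset hE hg
  have hq := h.2.1.inter_subset hE hg
  rw [Set.insert_eq_of_mem (Set.mem_insert _ _), convexHull_pair, Set.pair_eq_singleton] at hp hq
  rw [Set.union_inter_distrib_right, segment_symm ℝ r.toR3]
  exact Set.union_subset_union hp hq

/-- The result of inserting the vertex `r` into the edge that starts at `p`, if that edge satisfies
`test`. -/
def insertVertex (test : IntPoint → IntPoint → IntPoint → List IntEdge → Prop)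
    [∀ p q r st, Decidable (test p q r st)] (st : List IntEdge) (p r : IntPoint) :
    Option (List IntEdge) :=
  (st.find? (·.1 = p)).bind fun e =>
    let rest := st.filter (· ≠ e)
    if test e.1 e.2 r rest then some ((e.1, r) :: (r, e.2) :: rest) else none

/-- Moves of polygonal links: `insert p r` inserts the vertex `r` into the edge that starts at `p`,
and `delete r` removes the vertex `r`. -/
inductive PolygonMove
  | insert (p r : IntPoint)
  | delete (r : IntPoint)

/-- The list of edges after a move, if it is a triangle move. -/
def PolygonMove.apply (st : List IntEdge) : PolygonMove → Option (List IntEdge)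
  | .insert p r => insertVertex IsFreeTriangle st p r
  | .delete r =>
    (st.find? (·.2 = r)).bind fun e =>
      (st.find? (·.1 = r)).bind fun f =>
        let rest := (st.filter (· ≠ e)).filter (· ≠ f)
        if IsFreeTriangle e.1 f.2 r rest then some ((e.1, f.2) :: rest) else none

theorem exists_of_insertVertex_eq_some {test : IntPoint → IntPoint → IntPoint → List IntEdge → Prop}
    [∀ p q r st, Decidable (test p q r st)] {st st' : List IntEdge} {p r : IntPoint}
    (h : insertVertex test st p r = some st') :
    ∃ e ∈ st, test e.1 e.2 r (st.filter (· ≠ e)) ∧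
      st' = (e.1, r) :: (r, e.2) :: st.filter (· ≠ e) := by
  obtain ⟨e, he, h⟩ := Option.bind_eq_some_iff.1 h
  obtain ⟨htest, h⟩ := Option.ite_none_right_eq_some.1 h
  exact ⟨e, List.mem_of_find?_eq_some he, htest, (Option.some.inj h).symm⟩

theorem exists_of_apply_delete_eq_some {st st' : List IntEdge} {r : IntPoint}
    (h : (PolygonMove.delete r).apply st = some st') :
    ∃ p q, (p, r) ∈ st ∧ (r, q) ∈ st ∧
      IsFreeTriangle p q r ((st.filter (· ≠ (p, r))).filter (· ≠ (r, q))) ∧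
      st' = (p, q) :: (st.filter (· ≠ (p, r))).filter (· ≠ (r, q)) := by
  obtain ⟨⟨p, r'⟩, he, h⟩ := Option.bind_eq_some_iff.1 h
  obtain ⟨⟨r'', q⟩, hf, h⟩ := Option.bind_eq_some_iff.1 h
  obtain rfl : r' = r := by simpa using List.find?_some he
  obtain rfl : r'' = r' := by simpa using List.find?_some hf
  obtain ⟨hfree, h⟩ := Option.ite_none_right_eq_some.1 h
  exact ⟨p, q, List.mem_of_find?_eq_some he, List.mem_of_find?_eq_some hf, hfree,
    (Option.some.inj h).symm⟩

theorem of_foldlM_eq_some {α β : Type*} {f : α → β → Option α} {P : α → Prop}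
    (hf : ∀ a b a', P a → f a b = some a' → P a') :
    ∀ {l : List β} {a a' : α}, P a → l.foldlM f a = some a' → P a'
  | [], _, _, ha, h => Option.some.inj h ▸ ha
  | _ :: _, _, _, ha, h => by
    rw [List.foldlM_cons] at h
    obtain ⟨a₁, h₁, h⟩ := Option.bind_eq_some_iff.1 h
    exact of_foldlM_eq_some hf (hf _ _ a₁ ha h₁) h

namespace OrientedLink

/-- The link consists of the edges in `E` and the integer edges in `st`. -/
def Realizes (L : OrientedLink) (E : Set (R3 × R3)) (st : List IntEdge) : Prop :=
  L.edges = E ∪ edgeSet st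

theorem Realizes.of_perm {L : OrientedLink} {E : Set (R3 × R3)} {st st' : List IntEdge}
    (h : L.Realizes E st) (hst : st.Perm st') : L.Realizes E st' :=
  h.trans (by rw [edgeSet_eq_of_perm hst])

section Moves

variable {E : Set (R3 × R3)} (hE : IsBody E) {L : OrientedLink} {st st' : List IntEdge}
  (hL : L.Realizes E st)

include hL in
theorem Realizes.mem {e : IntEdge} (he : e ∈ st) : e.toR3 ∈ L.edges :=
  hL ▸ Or.inr (toR3_mem_edgeSet_iff.2 he)

include hL in
theorem Realizes.edges_eq_insert {e : IntEdge} (he : e ∈ st) :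
    L.edges = insert e.toR3 (E ∪ edgeSet (st.filter (· ≠ e))) := by
  rw [hL, edgeSet_eq_insert he, Set.union_insert]

include hE hL

theorem Realizes.notMem {e : IntEdge} (he : e ∈ st) (h₁ : e.1.InSlab) (h₂ : e.2.InSlab)
    {rest : List IntEdge} (hrest : e ∉ rest) : e.toR3 ∉ E ∪ edgeSet rest :=
  not_or.2 ⟨hE.notMem (L.nondegenerate _ (hL.mem he)) h₁.toR3_mem_slab h₂.toR3_mem_slab,
    mt toR3_mem_edgeSet_iff.1 hrest⟩

theorem Realizes.exists_of_insert {p r : IntPoint}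
    (h : (PolygonMove.insert p r).apply st = some st') :
    ∃ M : OrientedLink, M.Realizes E st' ∧ M.linkType = L.linkType := by
  obtain ⟨e, he, ⟨hfree, hturn⟩, rfl⟩ := exists_of_insertVertex_eq_some h
  obtain ⟨M, hM, hML⟩ := exists_triangle_split (hL.edges_eq_insert he)
    (hL.notMem hE he hfree.1 hfree.2.1 (by simp)) hturn.left_notMem_segment
    hturn.right_notMem_segment fun g hg => hfree.inter_subset hE hg
  refine ⟨M, ?_, hML⟩
  rw [Realizes, hM, edgeSet_cons, edgeSet_cons, Set.union_insert, Set.union_insert]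
  rfl

theorem Realizes.exists_of_delete {r : IntPoint} (h : (PolygonMove.delete r).apply st = some st') :
    ∃ M : OrientedLink, M.Realizes E st' ∧ M.linkType = L.linkType := by
  obtain ⟨p, q, he, hf, ⟨hfree, hturn⟩, rfl⟩ := exists_of_apply_delete_eq_some h
  have hfe : (r, q) ≠ (p, r) := by
    rintro ⟨⟩
    exact hturn.left_notMem_segment (left_mem_segment ℝ _ _)
  have hf' : (r, q) ∈ st.filter (· ≠ (p, r)) := List.mem_filter.2 ⟨hf, decide_eq_true hfe⟩
  have hLedges := hL.edges_eq_insert he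
  rw [edgeSet_eq_insert hf', Set.union_insert] at hLedges
  obtain ⟨hp, hq, hr, -⟩ := id hfree
  obtain ⟨M, hM, hML⟩ := exists_triangle_merge hLedges (hL.notMem hE he hp hr (by simp))
    (hL.notMem hE hf hr hq (by simp)) hturn.left_notMem_segment hturn.right_notMem_segment
    fun g hg => hfree.inter_subset hE hg
  refine ⟨M, ?_, hML⟩
  rw [Realizes, hM, edgeSet_cons, Set.union_insert]
  rfl

theorem Realizes.exists_of_moves {ms : List PolygonMove}
    (h : ∃ st'' ∈ ms.foldlM PolygonMove.apply st, st''.Perm st') :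
    ∃ M : OrientedLink, M.Realizes E st' ∧ M.linkType = L.linkType := by
  obtain ⟨st'', h, hst⟩ := h
  obtain ⟨M, hM, hML⟩ := of_foldlM_eq_some
    (P := fun st => ∃ M : OrientedLink, M.Realizes E st ∧ M.linkType = L.linkType)
    (fun st m st' ⟨M, hM, hML⟩ hm => by
      obtain ⟨N, hN, hNM⟩ : ∃ N : OrientedLink, N.Realizes E st' ∧ N.linkType = M.linkType := by
        cases m with
        | insert p r => exact hM.exists_of_insert hE hm
        | delete r => exact hM.exists_of_delete hE hm
      exact ⟨N, hN, hNM.trans hML⟩) ⟨L, hL, rfl⟩ h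
  exact ⟨M, hM.of_perm hst, hML⟩

theorem Realizes.exists_of_insertVertex {p r : IntPoint}
    (h : insertVertex IsFreePath st p r = some st') : ∃ M : OrientedLink, M.Realizes E st' := by
  obtain ⟨e, he, hfree, rfl⟩ := exists_of_insertVertex_eq_some h
  have hturn := hfree.2.2
  have hrest : L.edges \ {e.toR3} = E ∪ edgeSet (st.filter (· ≠ e)) := by
    rw [hL.edges_eq_insert he, Set.insert_sdiff_self_of_notMem
      (hL.notMem hE he hfree.1.1 hfree.2.1.1 (by simp))]
  refine ⟨L.splitEdge (hL.mem he) r.toR3 hturn.left_notMem_segment hturn.right_notMem_segment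
    fun g hg hne => hfree.inter_subset hE (hrest ▸ ⟨hg, hne⟩), ?_⟩
  change insert _ (insert _ (L.edges \ {e.toR3})) = _
  rw [hrest, edgeSet_cons, edgeSet_cons, Set.union_insert, Set.union_insert]
  rfl

theorem Realizes.exists_of_insertVertices {vs : List (IntPoint × IntPoint)}
    (h : ∃ st'' ∈ vs.foldlM (fun st v => insertVertex IsFreePath st v.1 v.2) st, st''.Perm st') :
    ∃ M : OrientedLink, M.Realizes E st' := by
  obtain ⟨st'', h, hst⟩ := h
  obtain ⟨M, hM⟩ := of_foldlM_eq_some (P := fun st => ∃ M : OrientedLink, M.Realizes E st)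
    (fun _ _ _ ⟨_, hM⟩ hv => hM.exists_of_insertVertex hE hv) ⟨L, hL⟩ h
  exact ⟨M, hM.of_perm hst⟩

end Moves

end OrientedLink

/-- A path once around the origin for `0 ≤ u ≤ 4`, along a square, with `squarePath k = I ^ k`. It
is used instead of the circle because it is piecewise affine. -/
noncomputable def squarePath (u : ℝ) : ℂ :=
  (max (1 - u) (u - 3) : ℝ) + (max (min u (2 - u)) (u - 4) : ℝ) * Complex.I

theorem squarePath_re (u : ℝ) : (squarePath u).re = max (1 - u) (u - 3) := by simp [squarePath]

theorem squarePath_im (u : ℝ) : (squarePath u).im = max (min u (2 - u)) (u - 4) := by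
  simp [squarePath]

theorem continuous_squarePath : Continuous squarePath := by
  unfold squarePath
  fun_prop

theorem squarePath_ne_zero (u : ℝ) : squarePath u ≠ 0 := by
  intro h
  obtain ⟨hre, him⟩ := Complex.ext_iff.1 h
  rw [squarePath_re, Complex.zero_re] at hre
  rw [squarePath_im, Complex.zero_im] at him
  grind

theorem squarePath_eq {k : ℕ} (hk : k < 4) {u : ℝ} (hku : k ≤ u) (huk : u ≤ k + 1) :
    squarePath u = Complex.I ^ k * (1 + (u - k) * (Complex.I - 1)) := by
  interval_cases k <;> push_cast at hku huk <;>
    apply Complex.ext <;> simp [squarePath_re, squarePath_im, pow_succ] <;> grind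

theorem squarePath_natCast {k : ℕ} (hk : k ≤ 4) : squarePath k = Complex.I ^ k := by
  obtain hk | rfl := hk.lt_or_eq
  · simp [squarePath_eq hk le_rfl]
  · apply Complex.ext <;> norm_num [squarePath_re, squarePath_im]

/-- The number of quarter turns by which the twist rotates the plane at `x`. -/
noncomputable def quarterTurns : ℝ → ℝ := transition (-10) (-8) 4 0

theorem quarterTurns_of_le {x : ℝ} (h : x ≤ -10) : quarterTurns x = 4 :=
  transition_of_le (by norm_num) _ _ h

theorem quarterTurns_of_ge {x : ℝ} (h : -8 ≤ x) : quarterTurns x = 0 :=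
  transition_of_ge (by norm_num) _ _ h

theorem quarterTurns_of_mem {x : ℝ} (h : -10 ≤ x) (h' : x ≤ -8) :
    quarterTurns x = -16 - 2 * x := by
  rw [quarterTurns, transition_of_mem (by norm_num) _ _ h h', lineMap_apply]
  simp only [vsub_eq_sub, vadd_eq_add, smul_eq_mul]
  ring

/-- A full turn of the left half-space about the `x`-axis. -/
noncomputable def twist : R3 → R3 := fiberMap 1 0 (squarePath ∘ quarterTurns) 0

theorem twist_of_eq_one {p : R3} (h : squarePath (quarterTurns p.1) = 1) : twist p = p := by
  simp [twist, fiberMap, h]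

theorem twist_of_le {p : R3} (h : p.1 ≤ -10) : twist p = p :=
  twist_of_eq_one <| by
    simpa [squarePath_natCast, quarterTurns_of_le h] using squarePath_natCast le_rfl

theorem twist_of_ge {p : R3} (h : -8 ≤ p.1) : twist p = p :=
  twist_of_eq_one <| by
    simpa [squarePath_natCast, quarterTurns_of_ge h] using squarePath_natCast (Nat.zero_le 4)

theorem IsBody.twist_eq {E : Set (R3 × R3)} (hE : IsBody E) {e : R3 × R3} (he : e ∈ E) {x : R3}
    (hx : x ∈ edgeSegment e) : twist x = x := by
  obtain h | h := hE e he
  · exact twist_of_le (h x hx).1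
  · exact twist_of_ge (by linarith [show -x.1 ≤ -10 from (h x hx).1])

/-- The effect of the twist on integer points with `-10 ≤ x`. -/
def IntPoint.twist (v : IntPoint) : IntPoint :=
  if v.1 = -17 then (v.1, -v.2.2, v.2.1)
  else if v.1 = -18 then (v.1, -v.2.1, -v.2.2)
  else if v.1 = -19 then (v.1, v.2.2, -v.2.1)
  else v

theorem IntPoint.twist_toR3 {v : IntPoint} (h : -20 ≤ v.1) :
    _root_.twist v.toR3 = v.twist.toR3 := by
  obtain ⟨x, y, z⟩ := v
  obtain h16 | h16 := le_or_gt (-16) x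
  · have hx : -8 ≤ (IntPoint.toR3 (x, y, z)).1 := by
      rify at h16
      simp only [IntPoint.toR3]
      linarith
    rw [twist_of_ge hx, IntPoint.twist, if_neg (by grind), if_neg (by grind), if_neg (by grind)]
  · simp only at h
    have hturns (k : ℕ) (hk : k ≤ 4) :
        squarePath (quarterTurns (((-16 - k : ℤ) : ℝ) / 2)) = Complex.I ^ k := by
      rify at hk
      rw [← squarePath_natCast (mod_cast hk), quarterTurns_of_mem] <;> push_cast
      · ring_nf
      all_goals linarith
    obtain ⟨k, hk, rfl⟩ : ∃ k : ℕ, k ≤ 4 ∧ x = -16 - k := ⟨(-16 - x).toNat, by lia, by lia⟩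
    simp only [_root_.twist, fiberMap, toR3, Function.comp_apply, hturns k hk]
    interval_cases k <;>
      simp [IntPoint.twist, Complex.equivRealProdCLM_apply, pow_succ, Complex.I_mul_I, neg_div]

/-- A test for edges that the twist maps to edges: either they are not affected by it, or they are
parallel to the `x`-axis and the rotation takes place along a side of the square. -/
def IntEdge.Twistable (e : IntEdge) : Prop :=
  (-16 ≤ e.1.1 ∧ -16 ≤ e.2.1) ∨
    (e.1.2 = e.2.2 ∧ ∃ k ∈ List.range 4, ∀ v ∈ [e.1, e.2], -17 - (k : ℤ) ≤ v.1 ∧ v.1 ≤ -16 - k)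

instance (e : IntEdge) : Decidable e.Twistable := inferInstanceAs (Decidable (_ ∨ _))

theorem IntEdge.Twistable.image_twist {e : IntEdge} (h : e.Twistable) :
    twist '' edgeSegment e.toR3 = edgeSegment (twist e.toR3.1, twist e.toR3.2) := by
  obtain ⟨h₁, h₂⟩ | ⟨he, k, hk, hv⟩ := h
  · rify at h₁ h₂
    refine image_fiberMap_of_const (u := 1) (fun x hx => ?_) fun _ _ => rfl
    have hx' : -8 ≤ x.1 := (convex_halfSpace_ge fstCoord.isLinear (-8)).segment_subset
      (by simp [toR3, IntPoint.toR3]; linarith) (by simp [toR3, IntPoint.toR3]; linarith) hx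
    simpa [squarePath_natCast, quarterTurns_of_ge hx'] using squarePath_natCast (Nat.zero_le 4)
  · simp only [List.forall_mem_cons, List.not_mem_nil, false_imp_iff, implies_true, and_true] at hv
    obtain ⟨⟨h₁, h₁'⟩, h₂, h₂'⟩ := hv
    rw [List.mem_range] at hk
    rify at h₁ h₂ h₁' h₂'
    refine image_fiberMap_of_snd_eq (by simp only [toR3, IntPoint.toR3, he])
      (u := -2 * Complex.I ^ k * (Complex.I - 1))
      (w := Complex.I ^ k * (1 - (16 + k) * (Complex.I - 1))) fun x hx => ?_
    have hx₁ : (-17 - k : ℝ) / 2 ≤ x.1 := (convex_halfSpace_ge fstCoord.isLinear _).segment_subset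
      (by simp [toR3, IntPoint.toR3]; linarith) (by simp [toR3, IntPoint.toR3]; linarith) hx
    have hx₂ : x.1 ≤ (-16 - k : ℝ) / 2 := (convex_halfSpace_le fstCoord.isLinear _).segment_subset
      (by simp [toR3, IntPoint.toR3]; linarith) (by simp [toR3, IntPoint.toR3]; linarith) hx
    have hk' : (k : ℝ) ≤ 3 := mod_cast Nat.le_of_lt_succ (n := 3) hk
    have : (0 : ℝ) ≤ k := k.cast_nonneg
    rw [Function.comp_apply, quarterTurns_of_mem (by linarith) (by linarith), squarePath_eq hk
      (by linarith) (by linarith)]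
    push_cast
    ring

theorem IntEdge.Twistable.le {e : IntEdge} (h : e.Twistable) : -20 ≤ e.1.1 ∧ -20 ≤ e.2.1 := by
  obtain h | ⟨-, k, hk, hv⟩ := h
  · lia
  · simp only [List.forall_mem_cons] at hv
    rw [List.mem_range] at hk
    lia

/-- The effect of the twist on integer edges. -/
def IntEdge.twist (e : IntEdge) : IntEdge := (e.1.twist, e.2.twist)

theorem edgeSet_map_twist {st : List IntEdge} (ht : ∀ e ∈ st, e.Twistable) :
    edgeSet (st.map IntEdge.twist) = Prod.map twist twist '' edgeSet st := by
  rw [edgeSet, edgeSet, Set.image_image]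
  simp only [List.mem_map]
  change _ '' (IntEdge.twist '' {e | e ∈ st}) = _
  rw [Set.image_image]
  refine Set.image_congr fun e he => ?_
  simp only [IntEdge.toR3, IntEdge.twist, Prod.map_apply, IntPoint.twist_toR3 (ht e he).le.1,
    IntPoint.twist_toR3 (ht e he).le.2]

theorem exists_isAmbientIsotopy_twist :
    ∃ H : unitInterval × R3 → R3, IsAmbientIsotopy H ∧ (fun p => H (1, p)) = twist := by
  obtain ⟨H, hH, hH₁⟩ := exists_isAmbientIsotopy_fiberMap one_pos 0
    (α := fun t x => squarePath (t * quarterTurns x)) (β := 0)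
    (continuous_squarePath.comp ((by fun_prop : Continuous fun t : unitInterval × ℝ =>
      (t.1 : ℝ)).mul ((continuous_transition _ _ _ _).comp continuous_snd))) continuous_const
    (fun _ _ => squarePath_ne_zero _)
    (fun _ => by simpa using squarePath_natCast (Nat.zero_le 4)) fun _ => rfl
  exact ⟨H, hH, funext fun p => by simp [hH₁, twist, Function.comp_def]⟩

theorem IsBody.image_twist {E : Set (R3 × R3)} (hE : IsBody E) :
    Prod.map twist twist '' E = E :=
  Set.EqOn.image_eq_self fun _ he =>
    Prod.ext (hE.twist_eq he (left_mem_segment ℝ _ _)) (hE.twist_eq he (right_mem_segment ℝ _ _))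

theorem OrientedLink.Realizes.exists_of_twist {E : Set (R3 × R3)} (hE : IsBody E)
    {L : OrientedLink} {st : List IntEdge} (hL : L.Realizes E st) (ht : ∀ e ∈ st, e.Twistable) :
    ∃ M : OrientedLink, M.Realizes E (st.map IntEdge.twist) ∧ M.linkType = L.linkType := by
  obtain ⟨H, hH, hH₁⟩ := exists_isAmbientIsotopy_twist
  have hseg : ∀ e ∈ L.edges, twist '' edgeSegment e = edgeSegment (twist e.1, twist e.2) := by
    rw [hL]
    rintro _ (he | ⟨e, he, rfl⟩)
    · rw [hE.twist_eq he (left_mem_segment ℝ _ _), hE.twist_eq he (right_mem_segment ℝ _ _)]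
      exact Set.EqOn.image_eq_self fun x hx => hE.twist_eq he hx
    · exact (ht e he).image_twist
  simp only [← hH₁] at hseg
  refine ⟨L.map (fun p => H (1, p)) (hH.2.1 1).injective hseg, ?_,
    (L.isotopic_map hH hseg).linkType_eq.symm⟩
  change Prod.map (fun p => H (1, p)) (fun p => H (1, p)) '' L.edges = _
  rw [hH₁, hL, Set.image_union, hE.image_twist, edgeSet_map_twist ht]

/-- The `j`-th strand between the heights `h + 1` and `h`, as an integer edge. -/
def verticalEdge (h : ℤ) (j : ℕ) : IntEdge :=
  ((2 * (j : ℤ), 0, 2 * h + 2), (2 * (j : ℤ), 0, 2 * h))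

theorem toR3_verticalEdge (h : ℤ) (j : ℕ) :
    (verticalEdge h j).toR3 = (((j : ℝ), 0, (h : ℝ) + 1), ((j : ℝ), 0, (h : ℝ))) := by
  simp only [verticalEdge, IntEdge.toR3, IntPoint.toR3, Prod.mk.injEq]
  push_cast
  refine ⟨⟨?_, ?_, ?_⟩, ?_, ?_, ?_⟩ <;> ring

/-- The edges of `crossingEdges n i (d / 2) h`, as integer edges. -/
def crossingList (n i : ℕ) (d h : ℤ) : List IntEdge :=
  ((List.range' 1 n).filter fun j => j ≠ i ∧ j ≠ i + 1).map (verticalEdge h) ++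
  [((2 * (i : ℤ), 0, 2 * h + 2), (2 * (i : ℤ) + 1, d, 2 * h + 1)),
   ((2 * (i : ℤ) + 1, d, 2 * h + 1), (2 * (i : ℤ) + 2, 0, 2 * h)),
   ((2 * (i : ℤ) + 2, 0, 2 * h + 2), (2 * (i : ℤ) + 1, -d, 2 * h + 1)),
   ((2 * (i : ℤ) + 1, -d, 2 * h + 1), (2 * (i : ℤ), 0, 2 * h))]

/-- The edges of `layerEdges n h`, as integer edges. -/
def layerList (n : ℕ) (h : ℤ) : BraidLetter → List IntEdge
  | .one => (List.range' 1 n).map (verticalEdge h)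
  | .sigma i => crossingList n i 1 h
  | .sigmaInv i => crossingList n i (-1) h

/-- The edges of `braidEdges n w`, as integer edges. -/
def braidList (n : ℕ) : List BraidLetter → List IntEdge
  | [] => []
  | l :: w => layerList n w.length l ++ braidList n w

theorem edgeSet_map_verticalEdge (h : ℤ) (l : List ℕ) :
    edgeSet (l.map (verticalEdge h)) =
      {e | ∃ j ∈ l, e = (((j : ℝ), 0, (h : ℝ) + 1), ((j : ℝ), 0, (h : ℝ)))} := by
  ext e
  simp only [edgeSet, Set.mem_image, Set.mem_ofPred_eq, List.mem_map, ← toR3_verticalEdge]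
  exact ⟨by rintro ⟨_, ⟨j, hj, rfl⟩, rfl⟩; exact ⟨j, hj, rfl⟩,
    by rintro ⟨j, hj, rfl⟩; exact ⟨_, ⟨j, hj, rfl⟩, rfl⟩⟩

theorem crossingEdges_eq_edgeSet (n i : ℕ) (d h : ℤ) :
    crossingEdges n i ((d : ℝ) / 2) h = edgeSet (crossingList n i d h) := by
  rw [crossingList, edgeSet_append, edgeSet_map_verticalEdge, crossingEdges]
  congr 1
  · ext e
    simp only [Set.mem_ofPred_eq, List.mem_filter, List.mem_range'_1, decide_eq_true_eq,
      and_assoc, Nat.lt_one_add_iff]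
  · have hhalf (x : ℝ) : (2 * x + 1) / 2 = x + 1 / 2 := by ring
    have hone (x : ℝ) : (2 * x + 2) / 2 = x + 1 := by ring
    simp [edgeSet_cons, edgeSet_nil, IntEdge.toR3, IntPoint.toR3, hhalf, hone, neg_div]

theorem layerEdges_eq_edgeSet (n : ℕ) (h : ℤ) (l : BraidLetter) :
    layerEdges n h l = edgeSet (layerList n h l) := by
  cases l with
  | one =>
    rw [layerList, edgeSet_map_verticalEdge]
    ext e
    simp only [layerEdges, Set.mem_ofPred_eq, List.mem_range'_1, and_assoc, Nat.lt_one_add_iff]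
  | sigma i =>
    simpa only [layerEdges, layerList, Int.cast_one] using crossingEdges_eq_edgeSet n i 1 h
  | sigmaInv i =>
    simpa only [layerEdges, layerList, Int.cast_neg, Int.cast_one, neg_div] using
      crossingEdges_eq_edgeSet n i (-1) h

theorem braidEdges_eq_edgeSet (n : ℕ) (w : List BraidLetter) :
    braidEdges n w = edgeSet (braidList n w) := by
  induction w with
  | nil => simp [braidEdges, braidList, edgeSet_nil]
  | cons l w ih =>
    rw [braidEdges, braidList, edgeSet_append, ih, ← layerEdges_eq_edgeSet, Int.cast_natCast]

/-- The endpoints of `n`-braids of length `k`, as integer points. -/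
def endpointList (n k : ℕ) : List IntPoint :=
  (List.range' 1 n).flatMap fun (j : ℕ) => [(2 * (j : ℤ), 0, 2 * (k : ℤ)), (2 * (j : ℤ), 0, 0)]

theorem toR3_mem_braidEndpoints {n k : ℕ} {v : IntPoint} (h : v ∈ endpointList n k) :
    v.toR3 ∈ braidEndpoints n k := by
  simp only [endpointList, List.mem_flatMap, List.mem_range'_1, List.mem_cons, List.not_mem_nil,
    or_false] at h
  obtain ⟨j, ⟨h₁, hn⟩, hv⟩ := h
  refine ⟨j, h₁, by lia, hv.imp ?_ ?_⟩ <;> rintro rfl <;> simp [IntPoint.toR3]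

/-- Half-spaces `⟨ν, v⟩ ≤ c` (for integer points `v`) which meet the cylinder of the braids of
length `k` at most in boundary points. -/
def outerHalfSpaces (k : ℕ) : List (IntPoint × ℤ) :=
  [((0, 0, -1), -(2 * k)), ((0, 0, 1), 0), ((0, -1, 0), -2)]

theorem le_functional_of_mem_braidCylinder {n k : ℕ} {H : IntPoint × ℤ}
    (hH : H ∈ outerHalfSpaces k) {x : R3} (hx : x ∈ braidCylinder n k) :
    (H.2 : ℝ) / 2 ≤ H.1.functional x := by
  obtain ⟨-, ⟨-, hy⟩, hz₀, hz⟩ := hx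
  simp only [outerHalfSpaces, List.mem_cons, List.not_mem_nil, or_false] at hH
  rcases hH with rfl | rfl | rfl <;> simp only [IntPoint.functional_apply] <;> push_cast <;>
    linarith

/-- A test for an integer edge to lie outside the cylinder, up to endpoints of the braids. -/
def IntEdge.IsOutside (n k : ℕ) (e : IntEdge) : Prop :=
  ∃ H ∈ outerHalfSpaces k, e.LiesBelow H.1 H.2 (endpointList n k)

instance (n k : ℕ) (e : IntEdge) : Decidable (e.IsOutside n k) :=
  inferInstanceAs (Decidable (∃ H ∈ outerHalfSpaces k, _))

theorem IntEdge.IsOutside.inter_subset {n k : ℕ} {e : IntEdge} (h : e.IsOutside n k) :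
    edgeSegment e.toR3 ∩ braidCylinder n k ⊆ braidEndpoints n k := by
  obtain ⟨H, hH, he⟩ := h
  rw [Set.inter_comm]
  refine (he.toR3.inter_subset fun x hx => le_functional_of_mem_braidCylinder hH hx).trans ?_
  rintro _ ⟨v, hv, rfl⟩
  exact toR3_mem_braidEndpoints hv

theorem OrientedLink.Realizes.isBraidIn {L : OrientedLink} {E : Set (R3 × R3)} (hE : IsBody E)
    {X : List IntEdge} {n : ℕ} {w : List BraidLetter} (hL : L.Realizes E (X ++ braidList n w))
    (hn : n ≤ 3) (hX : ∀ e ∈ X, e.IsOutside n w.length) : L.IsBraidIn n w (E ∪ edgeSet X) := by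
  refine ⟨?_, by rw [hL, edgeSet_append, braidEdges_eq_edgeSet, Set.union_assoc]⟩
  rintro e (he | ⟨e, he, rfl⟩)
  · rintro x ⟨hx, ⟨hx₀, hx₁⟩, -⟩
    have hn' : (n : ℝ) ≤ 3 := mod_cast hn
    obtain h | h := hE e he
    · have : x.1 ≤ -10 := (h x hx).1
      linarith
    · have : -x.1 ≤ -10 := (h x hx).1
      linarith
  · exact (hX e he).inter_subset

/-- The strands of the two parts of a split link in normal form. -/
def trivialStrands : List IntEdge :=
  [((-20, 0, 20), (-20, 0, -20)), ((20, 0, 20), (20, 0, -20))]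

/-- The two strands in normal form, outside the cylinder of the 2-braids: strand 1 of the braid
belongs to the left part and strand 2 to the right part (for pure braids). -/
def outsideTwo : List IntEdge :=
  [((-20, 0, 20), (2, 0, 4)), ((2, 0, 0), (-20, 0, -20)), ((20, 0, 20), (4, 0, 4)),
   ((4, 0, 0), (20, 0, -20))]

/-- The two strands in normal form, outside the cylinder of the 3-braids. For braids with the
permutation `(1 3)`, the left part runs through the strands from 1 to 3 and from 2 to 2, and the
right part through the strand from 3 to 1. -/
def outsideThree : List IntEdge :=
  [((-20, 0, 20), (2, 0, 6)), ((6, 0, 0), (12, 4, -2)), ((12, 4, -2), (4, 6, 14)),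
   ((4, 6, 14), (4, 0, 6)), ((4, 0, 0), (2, -4, -6)), ((2, -4, -6), (-20, 0, -20)),
   ((20, 0, 20), (6, 0, 6)), ((2, 0, 0), (20, 0, -20))]

/-- Vertices whose insertion into the trivial strands gives the clasp `σ₁²`. -/
def verticesClasp : List (IntPoint × IntPoint) :=
  [((20, 0, 20), (4, 0, 0)), ((-20, 0, 20), (2, 0, 0)), ((20, 0, 20), (4, 0, 4)),
   ((4, 0, 4), (2, 0, 2)), ((-20, 0, 20), (3, -1, 1)), ((2, 0, 2), (3, 1, 1)),
   ((4, 0, 4), (3, -1, 3)), ((-20, 0, 20), (4, 0, 2)), ((-20, 0, 20), (2, 0, 4)),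
   ((2, 0, 4), (3, 1, 3))]

/-- Vertices whose insertion into the trivial strands gives the clasp `σ₁⁻²`. -/
def verticesClaspInv : List (IntPoint × IntPoint) :=
  [((20, 0, 20), (4, 0, 0)), ((-20, 0, 20), (2, 0, 0)), ((20, 0, 20), (4, 0, 4)),
   ((4, 0, 4), (2, 0, 2)), ((-20, 0, 20), (3, 1, 1)), ((2, 0, 2), (3, -1, 1)),
   ((4, 0, 4), (3, 1, 3)), ((-20, 0, 20), (4, 0, 2)), ((-20, 0, 20), (2, 0, 4)),
   ((2, 0, 4), (3, -1, 3))]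

/-- Moves from the trivial strands to the trivial 2-braid. -/
def movesTrivialTwo : List PolygonMove :=
  [.insert (-20, 0, 20) (2, 0, 2), .insert (2, 0, 2) (2, 0, 0), .insert (20, 0, 20) (4, 0, 4),
   .insert (4, 0, 4) (4, 0, 0), .insert (-20, 0, 20) (2, 0, 4), .insert (4, 0, 4) (4, 0, 2)]

/-- Moves from the trivial strands to the braid `σ₁σ₂σ₁⁻¹`. -/
def movesPosPosNeg : List PolygonMove :=
  [.insert (-20, 0, 20) (2, -4, -6), .insert (-20, 0, 20) (6, 0, 0),
   .insert (20, 0, 20) (5, -1, 3), .insert (6, 0, 0) (3, -1, 5), .insert (6, 0, 0) (12, 4, -2),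
   .insert (-20, 0, 20) (6, 0, 2), .insert (20, 0, 20) (6, 0, 6), .insert (5, -1, 3) (3, 1, 1),
   .insert (-20, 0, 20) (3, 1, 5), .insert (6, 0, 6) (6, 0, 4), .insert (3, 1, 5) (4, 0, 4),
   .insert (3, -1, 5) (4, 0, 0), .insert (4, 0, 4) (5, 1, 3), .insert (3, 1, 1) (2, 0, 0),
   .insert (12, 4, -2) (4, 0, 6), .insert (-20, 0, 20) (2, 0, 6), .insert (5, -1, 3) (4, 0, 2),
   .insert (12, 4, -2) (4, 6, 14), .insert (3, -1, 5) (2, 0, 2), .insert (2, 0, 2) (3, -1, 1),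
   .insert (3, -1, 5) (2, 0, 4)]

/-- Moves from the trivial strands to the braid `σ₁⁻¹σ₂⁻¹σ₁`. -/
def movesNegNegPos : List PolygonMove :=
  [.insert (20, 0, 20) (6, 0, 4), .insert (-20, 0, 20) (6, 0, 0), .insert (6, 0, 4) (5, 1, 3),
   .insert (6, 0, 0) (2, -4, -6), .insert (5, 1, 3) (2, 0, 0), .insert (-20, 0, 20) (3, -1, 5),
   .insert (5, 1, 3) (3, -1, 1), .insert (6, 0, 0) (4, 0, 0), .insert (20, 0, 20) (6, 0, 6),
   .insert (6, 0, 0) (12, 4, -2), .insert (3, -1, 5) (4, 0, 4), .insert (4, 0, 4) (6, 0, 2),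
   .insert (4, 0, 4) (5, -1, 3), .insert (12, 4, -2) (3, 1, 5), .insert (12, 4, -2) (4, 0, 6),
   .insert (-20, 0, 20) (2, 0, 6), .insert (5, 1, 3) (4, 0, 2), .insert (12, 4, -2) (4, 6, 14),
   .insert (3, 1, 5) (2, 0, 2), .insert (2, 0, 2) (3, 1, 1), .insert (3, 1, 5) (2, 0, 4)]

/-- Moves from the clasp `σ₁²` to the braid `σ₁⁻¹σ₂σ₁`. -/
def movesNegPosPos : List PolygonMove :=
  [.delete (3, -1, 3), .delete (3, 1, 1), .delete (2, 0, 0), .delete (4, 0, 2),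
   .delete (4, 0, 0), .delete (2, 0, 4), .delete (4, 0, 4), .insert (-20, 0, 20) (3, 1, 1),
   .delete (3, 1, 3), .insert (2, 0, 2) (2, 0, 0), .delete (2, 0, 2),
   .insert (3, 1, 1) (2, -4, -6), .delete (3, -1, 1), .insert (-20, 0, 20) (4, 0, 6),
   .insert (-20, 0, 20) (3, -1, 5), .insert (3, -1, 5) (12, 4, -2), .insert (3, -1, 5) (5, 1, 3),
   .insert (5, 1, 3) (6, 0, 0), .insert (4, 0, 6) (2, 0, 2), .insert (20, 0, 20) (6, 0, 4),
   .insert (-20, 0, 20) (2, 0, 6), .insert (3, -1, 5) (4, 0, 4), .insert (6, 0, 4) (4, 0, 2),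
   .insert (5, 1, 3) (6, 0, 2), .insert (12, 4, -2) (4, 6, 14), .insert (4, 0, 6) (3, 1, 5),
   .insert (20, 0, 20) (6, 0, 6), .insert (3, 1, 5) (2, 0, 4), .insert (3, 1, 1) (4, 0, 0),
   .insert (4, 0, 2) (3, -1, 1), .insert (6, 0, 4) (5, -1, 3)]

/-- Moves from the clasp `σ₁⁻²` to `claspForTwist`. -/
def movesBeforeTwist : List PolygonMove :=
  [.delete (3, 1, 3), .delete (3, -1, 1), .delete (2, 0, 0), .delete (4, 0, 2),
   .delete (4, 0, 0), .delete (2, 0, 4), .delete (4, 0, 4), .insert (-20, 0, 20) (-19, 0, 20),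
   .insert (-19, 0, 20) (-18, 0, 20), .insert (-18, 0, 20) (-17, 0, 20),
   .insert (-17, 0, 20) (-16, 0, 20), .insert (3, 1, 1) (-19, 0, -20),
   .insert (3, 1, 1) (-18, 0, -20), .insert (3, 1, 1) (-17, 0, -20),
   .insert (3, 1, 1) (-16, 0, -20)]

/-- The clasp `σ₁⁻²`, with the vertices at which the twist turns the left strands. -/
def claspForTwist : List IntEdge :=
  [((-20, 0, 20), (-19, 0, 20)), ((-19, 0, 20), (-18, 0, 20)), ((-18, 0, 20), (-17, 0, 20)),
   ((-17, 0, 20), (-16, 0, 20)), ((-16, 0, 20), (3, -1, 3)), ((3, -1, 3), (3, 1, 1)),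
   ((3, 1, 1), (-16, 0, -20)), ((-16, 0, -20), (-17, 0, -20)), ((-17, 0, -20), (-18, 0, -20)),
   ((-18, 0, -20), (-19, 0, -20)), ((-19, 0, -20), (-20, 0, -20)), ((20, 0, 20), (2, 0, 2)),
   ((2, 0, 2), (20, 0, -20))]

/-- Moves from the twisted clasp `σ₁⁻²` to the braid `σ₁σ₂⁻¹σ₁⁻¹`. -/
def movesAfterTwist : List PolygonMove :=
  [.delete (-18, 0, -20), .delete (-16, 0, -20), .delete (-17, 20, 0), .delete (-19, -20, 0),
   .delete (-16, 0, 20), .delete (-17, -20, 0), .insert (3, 1, 1) (10, 9, -4), .delete (3, 1, 1),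
   .insert (10, 9, -4) (8, 7, 0), .delete (10, 9, -4), .insert (8, 7, 0) (16, 11, -1),
   .delete (8, 7, 0), .insert (-18, 0, 20) (-10, -1, 28), .delete (-18, 0, 20),
   .delete (-19, 20, 0), .insert (2, 0, 2) (-6, 5, 2), .delete (2, 0, 2),
   .insert (-6, 5, 2) (-5, 5, 7), .delete (-6, 5, 2), .insert (3, -1, 3) (1, 6, 4),
   .delete (3, -1, 3), .delete (16, 11, -1), .insert (1, 6, 4) (3, 2, 22), .delete (-10, -1, 28),
   .insert (-20, 0, 20) (12, 4, -2), .delete (1, 6, 4), .insert (20, 0, 20) (5, 5, -3),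
   .delete (-5, 5, 7), .insert (3, 2, 22) (2, 0, 4), .insert (-20, 0, 20) (3, 1, 5),
   .insert (3, 1, 5) (5, -1, 3), .insert (20, 0, 20) (2, 0, 0), .delete (5, 5, -3),
   .insert (12, 4, -2) (4, 6, 14), .delete (3, 2, 22), .insert (2, 0, 4) (2, -4, -6),
   .insert (20, 0, 20) (4, 0, 2), .insert (2, 0, 4) (3, -1, 1), .insert (3, -1, 1) (4, 0, 0),
   .insert (3, 1, 5) (4, 0, 4), .insert (20, 0, 20) (6, 0, 6), .insert (4, 6, 14) (3, -1, 5),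
   .insert (4, 6, 14) (4, 0, 6), .insert (4, 0, 2) (3, 1, 1), .insert (5, -1, 3) (6, 0, 0),
   .insert (5, -1, 3) (6, 0, 2), .insert (2, 0, 4) (2, 0, 2), .insert (6, 0, 6) (5, 1, 3),
   .insert (6, 0, 6) (6, 0, 4), .insert (-20, 0, 20) (2, 0, 6)]

open BraidLetter LaurentPolynomial

theorem T_two_add_T_neg_two_sub_two_ne_zero : (T 2 + T (-2) - 2 : LaurentPolynomial ℤ) ≠ 0 := by
  intro h
  have h2 : (2 : LaurentPolynomial ℤ) = T 0 + T 0 := by rw [T_zero]; norm_num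
  rw [h2] at h
  have hcoeff := congrArg (fun f : LaurentPolynomial ℤ => f.coeff 2) h
  simp [-T_zero] at hcoeff

theorem IsLinkInvariant.congr {D : OrientedLink → LaurentPolynomial ℤ} (hD : IsLinkInvariant D)
    {L M : OrientedLink} (h : L.linkType = M.linkType) : D L = D M :=
  congrArg (Quot.lift D hD) h

namespace OrientedLink

section Certificates

variable {E : Set (R3 × R3)} (hE : IsBody E) {L : OrientedLink}
include hE

theorem Realizes.exists_clasp (hL : L.Realizes E trivialStrands) :
    ∃ M : OrientedLink, M.Realizes E (outsideTwo ++ braidList 2 [sigma 1, sigma 1]) :=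
  hL.exists_of_insertVertices hE (vs := verticesClasp) (by decide +kernel)

theorem Realizes.exists_claspInv (hL : L.Realizes E trivialStrands) :
    ∃ M : OrientedLink, M.Realizes E (outsideTwo ++ braidList 2 [sigmaInv 1, sigmaInv 1]) :=
  hL.exists_of_insertVertices hE (vs := verticesClaspInv) (by decide +kernel)

theorem Realizes.exists_trivialTwo (hL : L.Realizes E trivialStrands) :
    ∃ M : OrientedLink, M.Realizes E (outsideTwo ++ braidList 2 [one, one]) ∧
      M.linkType = L.linkType :=
  hL.exists_of_moves hE (ms := movesTrivialTwo) (by decide +kernel)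

theorem Realizes.exists_posPosNeg (hL : L.Realizes E trivialStrands) :
    ∃ M : OrientedLink,
      M.Realizes E (outsideThree ++ braidList 3 [sigma 1, sigma 2, sigmaInv 1]) ∧
      M.linkType = L.linkType :=
  hL.exists_of_moves hE (ms := movesPosPosNeg) (by decide +kernel)

theorem Realizes.exists_negNegPos (hL : L.Realizes E trivialStrands) :
    ∃ M : OrientedLink,
      M.Realizes E (outsideThree ++ braidList 3 [sigmaInv 1, sigmaInv 2, sigma 1]) ∧
      M.linkType = L.linkType :=
  hL.exists_of_moves hE (ms := movesNegNegPos) (by decide +kernel)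

theorem Realizes.exists_negPosPos
    (hL : L.Realizes E (outsideTwo ++ braidList 2 [sigma 1, sigma 1])) :
    ∃ M : OrientedLink,
      M.Realizes E (outsideThree ++ braidList 3 [sigmaInv 1, sigma 2, sigma 1]) ∧
      M.linkType = L.linkType :=
  hL.exists_of_moves hE (ms := movesNegPosPos) (by decide +kernel)

theorem Realizes.exists_posNegNeg
    (hL : L.Realizes E (outsideTwo ++ braidList 2 [sigmaInv 1, sigmaInv 1])) :
    ∃ M : OrientedLink,
      M.Realizes E (outsideThree ++ braidList 3 [sigma 1, sigmaInv 2, sigmaInv 1]) ∧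
      M.linkType = L.linkType := by
  obtain ⟨K, hK, hKL⟩ : ∃ K : OrientedLink, K.Realizes E claspForTwist ∧
      K.linkType = L.linkType :=
    hL.exists_of_moves hE (ms := movesBeforeTwist) (by decide +kernel)
  obtain ⟨K', hK', hKK'⟩ := hK.exists_of_twist hE (by decide +kernel)
  obtain ⟨M, hM, hMK⟩ := hK'.exists_of_moves hE (ms := movesAfterTwist)
    (st' := outsideThree ++ braidList 3 [sigma 1, sigmaInv 2, sigmaInv 1]) (by decide +kernel)
  exact ⟨M, hM, hMK.trans (hKK'.trans hKL)⟩

theorem Realizes.isBraidIn_outsideTwo {w : List BraidLetter}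
    (hL : L.Realizes E (outsideTwo ++ braidList 2 w)) (hw : w.length = 2) :
    L.IsBraidIn 2 w (E ∪ edgeSet outsideTwo) :=
  hL.isBraidIn hE (by norm_num) (by rw [hw]; decide +kernel)

theorem Realizes.isBraidIn_outsideThree {w : List BraidLetter}
    (hL : L.Realizes E (outsideThree ++ braidList 3 w)) (hw : w.length = 3) :
    L.IsBraidIn 3 w (E ∪ edgeSet outsideThree) :=
  hL.isBraidIn hE le_rfl (by rw [hw]; decide +kernel)

end Certificates

theorem Realizes.skeinII {D : OrientedLink → LaurentPolynomial ℤ} (hD : IsLinkInvariant D)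
    (hII : SkeinRelationII D) {E : Set (R3 × R3)} (hE : IsBody E) {N Lp Lm : OrientedLink}
    (hN : N.Realizes E trivialStrands)
    (hLp : Lp.Realizes E (outsideTwo ++ braidList 2 [sigma 1, sigma 1]))
    (hLm : Lm.Realizes E (outsideTwo ++ braidList 2 [sigmaInv 1, sigmaInv 1])) :
    D Lp + D Lm = (T 2 + T (-2)) * D N := by
  obtain ⟨L₀, hL₀, hNL₀⟩ := hN.exists_trivialTwo hE
  rw [← hD.congr hNL₀]
  exact hII _ Lp Lm L₀ (hLp.isBraidIn_outsideTwo hE rfl) (hLm.isBraidIn_outsideTwo hE rfl)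
    (hL₀.isBraidIn_outsideTwo hE rfl)

theorem Realizes.skeinIII {D : OrientedLink → LaurentPolynomial ℤ} (hD : IsLinkInvariant D)
    (hIII : SkeinRelationIII D) {E : Set (R3 × R3)} (hE : IsBody E) {N Lp Lm : OrientedLink}
    (hN : N.Realizes E trivialStrands)
    (hLp : Lp.Realizes E (outsideTwo ++ braidList 2 [sigma 1, sigma 1]))
    (hLm : Lm.Realizes E (outsideTwo ++ braidList 2 [sigmaInv 1, sigmaInv 1])) :
    D N - D Lm = D Lp - D N := by
  obtain ⟨L₁, hL₁, h₁⟩ := hN.exists_posPosNeg hE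
  obtain ⟨L₂, hL₂, h₂⟩ := hLm.exists_posNegNeg hE
  obtain ⟨L₃, hL₃, h₃⟩ := hLp.exists_negPosPos hE
  obtain ⟨L₄, hL₄, h₄⟩ := hN.exists_negNegPos hE
  have h := hIII _ L₁ L₂ L₃ L₄ (hL₁.isBraidIn_outsideThree hE rfl)
    (hL₂.isBraidIn_outsideThree hE rfl) (hL₃.isBraidIn_outsideThree hE rfl)
    (hL₄.isBraidIn_outsideThree hE rfl)
  rwa [hD.congr h₁, hD.congr h₂, hD.congr h₃, hD.congr h₄] at h

theorem IsNormalForm.realizes {N : OrientedLink} {E : Set (R3 × R3)} (hN : N.IsNormalForm E) :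
    N.Realizes E trivialStrands := by
  rw [Realizes, hN.2, trivialStrands, edgeSet_cons, edgeSet_cons, edgeSet_nil]
  norm_num [IntEdge.toR3, IntPoint.toR3]

theorem IsNormalForm.eq_zero {D : OrientedLink → LaurentPolynomial ℤ} (hD : IsLinkInvariant D)
    (hII : SkeinRelationII D) (hIII : SkeinRelationIII D) {N : OrientedLink} {E : Set (R3 × R3)}
    (hN : N.IsNormalForm E) : D N = 0 := by
  obtain ⟨Lp, hLp⟩ := hN.realizes.exists_clasp hN.1
  obtain ⟨Lm, hLm⟩ := hN.realizes.exists_claspInv hN.1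
  have h₂ := hN.realizes.skeinII hD hII hN.1 hLp hLm
  have h₃ := hN.realizes.skeinIII hD hIII hN.1 hLp hLm
  have hmul : (T 2 + T (-2) - 2) * D N = 0 := by linear_combination -h₂ - h₃
  exact (mul_eq_zero.1 hmul).resolve_left T_two_add_T_neg_two_sub_two_ne_zero

theorem endpoints_mem_support {L : OrientedLink} {e : R3 × R3} (he : e ∈ L.edges) :
    e.1 ∈ L.support ∧ e.2 ∈ L.support :=
  ⟨Set.mem_biUnion he (left_mem_segment ℝ _ _), Set.mem_biUnion he (right_mem_segment ℝ _ _)⟩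

theorem IsSplit.exists_isNormalForm {L : OrientedLink} (hL : L.IsSplit) :
    ∃ (N : OrientedLink) (E : Set (R3 × R3)), N.IsNormalForm E ∧ N.linkType = L.linkType := by
  obtain ⟨-, -, A, B, M, -, -, hLM, hM, hA, hB⟩ := hL
  obtain ⟨N, E, hN, hNM⟩ := OrientedLink.exists_isNormalForm hM A.nonempty B.nonempty
    (fun e he => (endpoints_mem_support he).imp (hA _) (hA _))
    (fun e he => (endpoints_mem_support he).imp (hB _) (hB _))
  exact ⟨N, E, hN, hNM.trans hLM.linkType_eq.symm⟩

theorem IsSplit.eq_zero {D : OrientedLink → LaurentPolynomial ℤ} (hD : IsLinkInvariant D)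
    (hII : SkeinRelationII D) (hIII : SkeinRelationIII D) {L : OrientedLink} (hL : L.IsSplit) :
    D L = 0 := by
  obtain ⟨N, E, hN, hNL⟩ := hL.exists_isNormalForm
  rw [← hD.congr hNL, hN.eq_zero hD hII hIII]

end OrientedLink

theorem corollary4p4 (D : OrientedLink → LaurentPolynomial ℤ) (hD : IsLinkInvariant D)
    (hII : SkeinRelationII D) (hIII : SkeinRelationIII D) :
    (∀ L : OrientedLink, L.IsSplit → D L = 0) ∧
    (∀ L O M : OrientedLink, O.IsUnknot → OrientedLink.IsSplitUnion L O M → D M = 0) :=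
  ⟨fun _ hL => hL.eq_zero hD hII hIII,
    fun L O _ _ hM => OrientedLink.IsSplit.eq_zero hD hII hIII ⟨L, O, hM⟩⟩
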